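/- Let $(M_1,g_1)$ and $(M_2,g_2)$ be non-empty smooth pseudo-Riemannian manifolds without boundary, of finite dimensions $n_1$ and $n_2$, put $n=n_1+n_2$, and let $f_1:M_1\to(0,\infty)$ and $f_2:M_2\to(0,\infty)$ be smooth. Let $M={}_{f_2}M_1\times_{f_1}M_2$ be the doubly warped product, i.e. $M_1\times M_2$ with the metric $$g=(f_2\circ\pi_2)^2\,\pi_1^*g_1\oplus(f_1\circ\pi_1)^2\,\pi_2^*g_2 ,$$ where $\pi_1,\pi_2$ are the projections. A pseudo-Riemannian manifold with Levi-Civita connection $D$ and Ricci tensor $\mathrm{Ric}$ is called Einstein-like of class $\mathcal A$ if its Ricci tensor is Killing, that is, $$(D_X\mathrm{Ric})(Y,Z)+(D_Y\mathrm{Ric})(Z,X)+(D_Z\mathrm{Ric})(X,Y)=0\quad\text{for all } X,Y,Z .$$ Denote by $D^i$, $\nabla^i$, $\Delta^i$ the Levi-Civita connection, gradient and Laplacian (trace of the Hessian) of $(M_i,g_i)$, by $H^{f_i}$ the Hessian of $f_i$ on $(M_i,g_i)$ and, for $\{i,j\}=\{1,2\}$, put $$\mathcal F^i=\frac{n_j}{f_i}\,H^{f_i},\qquad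 f_i^\diamond=f_i\,\Delta^i f_i+(n_j-1)\,g_i(\nabla^i f_i,\nabla^i f_i).$$ Assume that $(M,g)$ is of class $\mathcal A$. Then, for each $i\in\{1,2\}$ and with $j$ the other index, $(M_i,g_i)$ is of class $\mathcal A$ if and only if $$(D^i_{X}\mathcal F^i)(X,X)=\frac{2}{f_i^3}\,X(f_i)\,g_i(X,X)\,\Big[f_j^\diamond+(n-2)\,(\nabla^j f_j)(f_j)\Big]$$ holds at every point of $M_1\times M_2$ for all tangent vectors $X$ to $M_i$ (equivalently, for all vector fields $X$ on $M_i$; functions and tensors on the factors are identified with their lifts to the product). -/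

import Mathlib

set_option maxSynthPendingDepth 3

open scoped Manifold ContDiff

noncomputable section

/-! ## Tensor calculus in a coordinate domain

`E` is a finite-dimensional coordinate space and `G : E → E →L[ℝ] E →L[ℝ] ℝ` is the coordinate
expression of a pseudo-Riemannian metric: `G e u v` is the value of the metric at the point `e` on
the vectors with constant components `u`, `v`. A `(0,2)`-tensor field is given by its coordinate
expression `T : E → E → E → ℝ`. -/

namespace Coord

section

variable {E : Type*} [NormedAddCommGroup E] [NormedSpace ℝ E]

/-- The vector `α♯` that represents the covector `α` with respect to the bilinear form `b`:
`b (sharp b α) w = α w` whenever `b` is nondegenerate (and `E` is finite-dimensional). -/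
def sharp (b : E →L[ℝ] E →L[ℝ] ℝ) : (E →L[ℝ] ℝ) →L[ℝ] E :=
  ContinuousLinearMap.inverse b

/-- Christoffel symbols of the first kind,
`(u, v, w) ↦ (∂_u G(v, w) + ∂_v G(u, w) - ∂_w G(u, v)) / 2`. -/
def christoffelFirst (G : E → E →L[ℝ] E →L[ℝ] ℝ) (e : E) : E →L[ℝ] E →L[ℝ] E →L[ℝ] ℝ :=
  let A : E →L[ℝ] E →L[ℝ] E →L[ℝ] ℝ := fderiv ℝ G e
  let S : (E →L[ℝ] E →L[ℝ] ℝ) →L[ℝ] (E →L[ℝ] E →L[ℝ] ℝ) :=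
    (ContinuousLinearMap.flipₗᵢ ℝ E E ℝ).toContinuousLinearEquiv.toContinuousLinearMap
  (2⁻¹ : ℝ) • (A + A.flip - S ∘L A.flip)

theorem christoffelFirst_apply (G : E → E →L[ℝ] E →L[ℝ] ℝ) (e u v w : E) :
    christoffelFirst G e u v w
      = 2⁻¹ * (fderiv ℝ G e u v w + fderiv ℝ G e v u w - fderiv ℝ G e w u v) := by
  simp [christoffelFirst]

/-- Christoffel symbols of the Levi-Civita connection, as a bilinear map:
`christoffel G e u v` is the covariant derivative `∇_u v` at `e` of the field with constant
components `v`. -/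
def christoffel (G : E → E →L[ℝ] E →L[ℝ] ℝ) (e : E) : E →L[ℝ] E →L[ℝ] E :=
  (ContinuousLinearMap.compL ℝ E (E →L[ℝ] ℝ) E (sharp (G e))) ∘L christoffelFirst G e

theorem christoffel_apply (G : E → E →L[ℝ] E →L[ℝ] ℝ) (e u v : E) :
    christoffel G e u v = sharp (G e) (christoffelFirst G e u v) := by
  simp [christoffel]

/-- The Riemann curvature `R(u, v) w = ∇_u ∇_v w - ∇_v ∇_u w` at `e`, for constant component
vectors `u`, `v`, `w` (whose Lie brackets vanish). -/
def curvature (G : E → E →L[ℝ] E →L[ℝ] ℝ) (e u v w : E) : E :=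
  fderiv ℝ (christoffel G) e u v w - fderiv ℝ (christoffel G) e v u w
    + christoffel G e u (christoffel G e v w) - christoffel G e v (christoffel G e u w)

/-- The Ricci tensor `Ric(v, w) = trace (u ↦ R(u, v) w)` (positive on round spheres). -/
def ricci (G : E → E →L[ℝ] E →L[ℝ] ℝ) (e v w : E) : ℝ :=
  LinearMap.trace ℝ E
    { toFun := fun u => curvature G e u v w
      map_add' := fun a b => by simp only [curvature, map_add, add_apply]; abel
      map_smul' := fun c a => by
        simp only [curvature, map_smul, smul_apply, RingHom.id_apply]
        module }

/-- The Hessian `∇² f (u, v) = u (v f) - (∇_u v) f`. -/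
def hessian (G : E → E →L[ℝ] E →L[ℝ] ℝ) (f : E → ℝ) (e : E) : E →L[ℝ] E →L[ℝ] ℝ :=
  fderiv ℝ (fderiv ℝ f) e - (ContinuousLinearMap.compL ℝ E E ℝ (fderiv ℝ f e)) ∘L christoffel G e

theorem hessian_apply (G : E → E →L[ℝ] E →L[ℝ] ℝ) (f : E → ℝ) (e u v : E) :
    hessian G f e u v = fderiv ℝ (fderiv ℝ f) e u v - fderiv ℝ f e (christoffel G e u v) := by
  simp [hessian]

/-- The gradient of `f`. -/
def gradient (G : E → E →L[ℝ] E →L[ℝ] ℝ) (f : E → ℝ) (e : E) : E :=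
  sharp (G e) (fderiv ℝ f e)

/-- The Laplacian of `f`, i.e. the trace of its Hessian with respect to the metric. -/
def laplacian (G : E → E →L[ℝ] E →L[ℝ] ℝ) (f : E → ℝ) (e : E) : ℝ :=
  LinearMap.trace ℝ E (sharp (G e) ∘L hessian G f e : E →L[ℝ] E)

/-- The covariant derivative of a `(0,2)`-tensor field:
`(∇_u T)(v, w) = u (T(v, w)) - T(∇_u v, w) - T(v, ∇_u w)`. -/
def covDeriv (G : E → E →L[ℝ] E →L[ℝ] ℝ) (T : E → E → E → ℝ) (e u v w : E) : ℝ :=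
  fderiv ℝ (fun e' => T e' v w) e u
    - T e (christoffel G e u v) w - T e v (christoffel G e u w)

end

end Coord

/-! ## Pseudo-Riemannian manifolds

Differential operators at a point `x` are computed in the preferred chart `extChartAt I x` at
`x`, and tangent vectors at `x` are turned into coordinate vectors by the differential of that
chart. All of the expressions below are tensorial, so the choice of chart plays no role. -/

namespace PseudoRiemannian

section

variable {E : Type*} [NormedAddCommGroup E] [NormedSpace ℝ E]
  {H : Type*} [TopologicalSpace H] (I : ModelWithCorners ℝ E H)
  {M : Type*} [TopologicalSpace M] [ChartedSpace H M]

/-- A field of bilinear forms on the tangent spaces of `M`. -/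
abbrev BilinField (M : Type*) [TopologicalSpace M] [ChartedSpace H M] : Type _ :=
  (x : M) → TangentSpace I x →L[ℝ] TangentSpace I x →L[ℝ] ℝ

variable {I}

/-- A field of bilinear forms is a (smooth) pseudo-Riemannian metric. -/
structure IsMetric [IsManifold I ∞ M] (g : BilinField I M) : Prop where
  symm : ∀ (x : M) (v w : TangentSpace I x), g x v w = g x w v
  nondegenerate : ∀ (x : M) (v : TangentSpace I x), (∀ w, g x v w = 0) → v = 0
  contMDiff : ContMDiff I (I.prod 𝓘(ℝ, E →L[ℝ] E →L[ℝ] ℝ)) ∞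
    (fun x => Bundle.TotalSpace.mk' (E →L[ℝ] E →L[ℝ] ℝ)
      (E := fun x : M => TangentSpace I x →L[ℝ] TangentSpace I x →L[ℝ] ℝ) x (g x))

/-- The coordinates of a tangent vector at `x` in the preferred chart at `x`. -/
def coords (x : M) (v : TangentSpace I x) : E :=
  mfderiv I 𝓘(ℝ, E) (extChartAt I x) x v

/-- The coordinate expression, in the preferred chart at `x`, of a field of bilinear forms. -/
def inChart (g : BilinField I M) (x : M) (e : E) : E →L[ℝ] E →L[ℝ] ℝ :=
  let A : E →L[ℝ] TangentSpace I ((extChartAt I x).symm e) :=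
    mfderiv 𝓘(ℝ, E) I (extChartAt I x).symm e
  (ContinuousLinearMap.precomp ℝ A) ∘L (g ((extChartAt I x).symm e)) ∘L A

theorem inChart_apply (g : BilinField I M) (x : M) (e u v : E) :
    inChart g x e u v = g ((extChartAt I x).symm e)
      (mfderiv 𝓘(ℝ, E) I (extChartAt I x).symm e u)
      (mfderiv 𝓘(ℝ, E) I (extChartAt I x).symm e v) := rfl

/-- The coordinate expression of a function in the preferred chart at `x`. -/
def funInChart (I : ModelWithCorners ℝ E H) (f : M → ℝ) (x : M) (e : E) : ℝ :=
  f ((extChartAt I x).symm e)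

/-- The covariant derivative `(D_X T)(Y, Z)` at `x`, with respect to the Levi-Civita connection `D`
of `g`, of the `(0,2)`-tensor field whose coordinate expression in the preferred chart at `x` is
`T x`. -/
def covDeriv (g : BilinField I M) (T : M → E → E → E → ℝ) (x : M) (X Y Z : TangentSpace I x) : ℝ :=
  Coord.covDeriv (inChart g x) (T x) (extChartAt I x x) (coords x X) (coords x Y) (coords x Z)

/-- The Ricci tensor of `g`, through its coordinate expressions. -/
def ricci (g : BilinField I M) (x : M) : E → E → E → ℝ :=
  Coord.ricci (inChart g x)

/-- The metric `g` is Einstein-like of class `𝒜`: its Ricci tensor is Killing. -/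
def IsClassA (g : BilinField I M) : Prop :=
  ∀ (x : M) (X Y Z : TangentSpace I x),
    covDeriv g (ricci g) x X Y Z + covDeriv g (ricci g) x Y Z X + covDeriv g (ricci g) x Z X Y = 0

/-- The tensor `(m / f) Hess f`, through its coordinate expressions. -/
def warpingHessian (g : BilinField I M) (m : ℕ) (f : M → ℝ) (x : M) : E → E → E → ℝ :=
  fun e v w => (m / funInChart I f x e) * Coord.hessian (inChart g x) (funInChart I f x) e v w

/-- The squared length `g(∇f, ∇f) = (∇f)(f)` of the gradient of `f`: the derivative of `f` in the
direction of its gradient. -/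
def gradSq (g : BilinField I M) (f : M → ℝ) (x : M) : ℝ :=
  fderiv ℝ (funInChart I f x) (extChartAt I x x)
    (Coord.gradient (inChart g x) (funInChart I f x) (extChartAt I x x))

/-- The Laplacian of `f` with respect to `g`. -/
def laplacian (g : BilinField I M) (f : M → ℝ) (x : M) : ℝ :=
  Coord.laplacian (inChart g x) (funInChart I f x) (extChartAt I x x)

/-- `f^◇ = f Δf + (m - 1) g(∇f, ∇f)`. -/
def diamond (g : BilinField I M) (m : ℕ) (f : M → ℝ) (x : M) : ℝ :=
  f x * laplacian g f x + ((m : ℝ) - 1) * gradSq g f x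

end

section

variable {E₁ : Type*} [NormedAddCommGroup E₁] [NormedSpace ℝ E₁]
  {H₁ : Type*} [TopologicalSpace H₁] {I₁ : ModelWithCorners ℝ E₁ H₁}
  {M₁ : Type*} [TopologicalSpace M₁] [ChartedSpace H₁ M₁]
  {E₂ : Type*} [NormedAddCommGroup E₂] [NormedSpace ℝ E₂]
  {H₂ : Type*} [TopologicalSpace H₂] {I₂ : ModelWithCorners ℝ E₂ H₂}
  {M₂ : Type*} [TopologicalSpace M₂] [ChartedSpace H₂ M₂]

/-- The doubly warped product metric `(f₂ ∘ π₂)² π₁^* g₁ + (f₁ ∘ π₁)² π₂^* g₂` on `M₁ × M₂`. -/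
def doublyWarped (g₁ : BilinField I₁ M₁) (g₂ : BilinField I₂ M₂) (f₁ : M₁ → ℝ) (f₂ : M₂ → ℝ) :
    BilinField (I₁.prod I₂) (M₁ × M₂) := fun p =>
  let P₁ : TangentSpace (I₁.prod I₂) p →L[ℝ] TangentSpace I₁ p.1 :=
    mfderiv (I₁.prod I₂) I₁ (Prod.fst : M₁ × M₂ → M₁) p
  let P₂ : TangentSpace (I₁.prod I₂) p →L[ℝ] TangentSpace I₂ p.2 :=
    mfderiv (I₁.prod I₂) I₂ (Prod.snd : M₁ × M₂ → M₂) p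
  (f₂ p.2) ^ 2 • ((ContinuousLinearMap.precomp ℝ P₁) ∘L (g₁ p.1) ∘L P₁)
    + (f₁ p.1) ^ 2 • ((ContinuousLinearMap.precomp ℝ P₂) ∘L (g₂ p.2) ∘L P₂)

theorem doublyWarped_apply (g₁ : BilinField I₁ M₁) (g₂ : BilinField I₂ M₂) (f₁ : M₁ → ℝ)
    (f₂ : M₂ → ℝ) (p : M₁ × M₂) (v w : TangentSpace (I₁.prod I₂) p) :
    doublyWarped g₁ g₂ f₁ f₂ p v w
      = (f₂ p.2) ^ 2 * g₁ p.1 v.1 w.1 + (f₁ p.1) ^ 2 * g₂ p.2 v.2 w.2 := by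
  simp only [doublyWarped, mfderiv_fst, mfderiv_snd]
  rfl

end

end PseudoRiemannian

end

/-! The Ricci tensor is symmetric, so by polarization class A means that the cubic form
$(D_X\mathrm{Ric})(X,X)$ vanishes. On the product this form is only needed on vectors tangent to one
factor, say $X$ tangent to $M_1$.

Three facts determine it. The leaves are umbilic: $D_XX=D^1_XX-\frac{f_2}{f_1^2}g_1(X,X)\nabla^2f_2$
(`christoffel_inl_inl`). On a leaf, $\mathrm{Ric}=\mathrm{Ric}_1-\mathcal
F^1-f_1^{-2}f_2^\diamond\,g_1$ (`ricci_inl_inl`). Mixed terms are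
$\mathrm{Ric}(X,V)=(n-2)\frac{X(f_1)}{f_1}\frac{V(f_2)}{f_2}$ (`ricci_inl_inr`). Differentiating
$f_1^{-2}$ along $X$ produces the $f_2^\diamond$ term. The vertical part of $D_XX$, fed twice into
the mixed Ricci tensor, produces the $(n-2)(\nabla^2f_2)(f_2)$ term. Hence (`covDeriv_ricci_inl`)
$$(D_X\mathrm{Ric})(X,X)=(D^1_X\mathrm{Ric}_1)(X,X)-(D^1_X\mathcal
F^1)(X,X)+\tfrac{2}{f_1^3}X(f_1)g_1(X,X)\big[f_2^\diamond+(n-2)(\nabla^2f_2)(f_2)\big].$$ The left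
side is zero by assumption, so the first term on the right vanishes exactly when the stated equation
holds. The other factor follows by exchanging the roles. -/

namespace Coord

/-! ### Pseudo-Riemannian calculus on an open set of a vector space. -/

section Metric

variable {E : Type*} [NormedAddCommGroup E] [NormedSpace ℝ E]

/-- `G` is the coordinate expression of a smooth pseudo-Riemannian metric on the open set `U`. -/
structure IsMetricOn (G : E → E →L[ℝ] E →L[ℝ] ℝ) (U : Set E) : Prop where
  isOpen : IsOpen U
  symm : ∀ e ∈ U, ∀ v w, G e v w = G e w v
  nondegenerate : ∀ e ∈ U, ∀ v, (∀ w, G e v w = 0) → v = 0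
  contDiffOn : ContDiffOn ℝ ∞ G U

variable {G : E → E →L[ℝ] E →L[ℝ] ℝ} {U : Set E} {e : E} {f : E → ℝ}

theorem fderiv_contDiffOn {F : Type*} [NormedAddCommGroup F] [NormedSpace ℝ F] {g : E → F}
    (hU : IsOpen U) (hg : ContDiffOn ℝ ∞ g U) : ContDiffOn ℝ ∞ (fderiv ℝ g) U :=
  hg.fderiv_of_isOpen hU (by simp)

theorem differentiableAt_of_contDiffOn {F : Type*} [NormedAddCommGroup F] [NormedSpace ℝ F]
    {g : E → F} (hU : IsOpen U) (hg : ContDiffOn ℝ ∞ g U) (he : e ∈ U) :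
    DifferentiableAt ℝ g e :=
  (hg.contDiffAt (hU.mem_nhds he)).differentiableAt (by simp)

theorem isSymmSndFDerivAt_of_contDiffOn {F : Type*} [NormedAddCommGroup F] [NormedSpace ℝ F]
    {g : E → F} (hU : IsOpen U) (hg : ContDiffOn ℝ ∞ g U) (he : e ∈ U) :
    IsSymmSndFDerivAt ℝ g e :=
  (hg.contDiffAt (hU.mem_nhds he)).isSymmSndFDerivAt (by simpa using ENat.LEInfty.out)

theorem hasFDerivAt_div {a b : E → ℝ} {a' b' : E →L[ℝ] ℝ} (ha : HasFDerivAt a a' e)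
    (hb : HasFDerivAt b b' e) (h0 : b e ≠ 0) :
    HasFDerivAt (fun e => a e / b e) ((b e ^ 2)⁻¹ • (b e • a' - a e • b')) e := by
  have h := ha.mul ((hasDerivAt_inv h0).comp_hasFDerivAt e hb)
  refine (h.congr_fderiv ?_).congr_of_eventuallyEq (by simp [div_eq_mul_inv]; rfl)
  ext v
  simp
  field_simp
  ring

theorem IsMetricOn.ext_of_apply (h : IsMetricOn G U) (he : e ∈ U) {v v' : E}
    (hv : ∀ w, G e v w = G e v' w) : v = v' :=
  sub_eq_zero.1 (h.nondegenerate e he _ fun w => by simp [hv w])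

theorem IsMetricOn.contDiffOn_fderiv (h : IsMetricOn G U) : ContDiffOn ℝ ∞ (fderiv ℝ G) U :=
  fderiv_contDiffOn h.isOpen h.contDiffOn

theorem IsMetricOn.differentiableAt (h : IsMetricOn G U) (he : e ∈ U) : DifferentiableAt ℝ G e :=
  differentiableAt_of_contDiffOn h.isOpen h.contDiffOn he

theorem IsMetricOn.fderiv_apply_apply (h : IsMetricOn G U) (he : e ∈ U) (u v w : E) :
    fderiv ℝ (fun e' => G e' v w) e u = fderiv ℝ G e u v w := by
  have h1 := ((h.differentiableAt he).hasFDerivAt.clm_apply (hasFDerivAt_const v e)).clm_apply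
    (hasFDerivAt_const w e)
  rw [h1.fderiv]
  simp

theorem IsMetricOn.fderiv_symm (h : IsMetricOn G U) (he : e ∈ U) (u v w : E) :
    fderiv ℝ G e u v w = fderiv ℝ G e u w v := by
  rw [← h.fderiv_apply_apply he, ← h.fderiv_apply_apply he]
  have : (fun e' => G e' v w) =ᶠ[nhds e] fun e' => G e' w v := by
    filter_upwards [h.isOpen.mem_nhds he] with e' he' using h.symm e' he' v w
  rw [this.fderiv_eq]

/-- The linear map `u ↦ R(u, v) w` whose trace is the Ricci tensor. -/
noncomputable def curvatureMap (G : E → E →L[ℝ] E →L[ℝ] ℝ) (e v w : E) : E →ₗ[ℝ] E where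
  toFun u := curvature G e u v w
  map_add' a b := by simp only [curvature, map_add, add_apply]; abel
  map_smul' c a := by
    simp only [curvature, map_smul, smul_apply, RingHom.id_apply]
    module

theorem ricci_eq (v w : E) : ricci G e v w = LinearMap.trace ℝ E (curvatureMap G e v w) := rfl

theorem ricci_add_left (v v' w : E) : ricci G e (v + v') w = ricci G e v w + ricci G e v' w := by
  rw [ricci_eq, ricci_eq, ricci_eq, ← map_add]
  congr 1
  ext u
  simp only [curvatureMap, LinearMap.coe_mk, AddHom.coe_mk, LinearMap.add_apply, curvature,
    map_add, add_apply]
  abel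

theorem ricci_smul_left (c : ℝ) (v w : E) : ricci G e (c • v) w = c * ricci G e v w := by
  rw [ricci_eq, ricci_eq, ← smul_eq_mul, ← map_smul]
  congr 1
  ext u
  simp only [curvatureMap, LinearMap.coe_mk, AddHom.coe_mk, LinearMap.smul_apply, curvature,
    map_smul, smul_apply]
  module

variable [FiniteDimensional ℝ E]

/-- A nondegenerate bilinear form on a finite-dimensional space is an isomorphism onto the dual. -/
theorem exists_equiv_of_nondegenerate (b : E →L[ℝ] E →L[ℝ] ℝ)
    (hb : ∀ v, (∀ w, b v w = 0) → v = 0) : ∃ B : E ≃L[ℝ] (E →L[ℝ] ℝ), (B : E →L[ℝ] E →L[ℝ] ℝ) = b := by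
  have hinj : Function.Injective (b : E →ₗ[ℝ] E →L[ℝ] ℝ) := by
    refine (injective_iff_map_eq_zero _).2 fun v hv => hb v fun w => ?_
    have := congrArg (fun α : E →L[ℝ] ℝ => α w) hv
    simpa using this
  have hdim : Module.finrank ℝ E = Module.finrank ℝ (E →L[ℝ] ℝ) := by
    rw [← (LinearMap.toContinuousLinearMap (𝕜 := ℝ) (E := E) (F' := ℝ)).finrank_eq]
    exact (Subspace.dual_finrank_eq (K := ℝ) (V := E)).symm
  refine ⟨(LinearEquiv.ofInjectiveOfFinrankEq (b : E →ₗ[ℝ] E →L[ℝ] ℝ) hinj hdim).toContinuousLinearEquiv, ?_⟩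
  ext v w
  rfl

theorem apply_sharp (b : E →L[ℝ] E →L[ℝ] ℝ) (hb : ∀ v, (∀ w, b v w = 0) → v = 0)
    (α : E →L[ℝ] ℝ) (w : E) : b (sharp b α) w = α w := by
  obtain ⟨B, rfl⟩ := exists_equiv_of_nondegenerate b hb
  simp [sharp]

namespace IsMetricOn

theorem apply_sharp (h : IsMetricOn G U) (he : e ∈ U) (α : E →L[ℝ] ℝ) (w : E) :
    G e (sharp (G e) α) w = α w :=
  Coord.apply_sharp _ (h.nondegenerate e he) α w

theorem apply_gradient (h : IsMetricOn G U) (he : e ∈ U) (w : E) :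
    G e (gradient G f e) w = fderiv ℝ f e w :=
  h.apply_sharp he _ w

theorem apply_christoffel (h : IsMetricOn G U) (he : e ∈ U) (u v w : E) :
    G e (christoffel G e u v) w = christoffelFirst G e u v w := by
  rw [christoffel_apply, h.apply_sharp he]

theorem contDiffOn_sharp (h : IsMetricOn G U) : ContDiffOn ℝ ∞ (fun e => sharp (G e)) U := by
  have := FiniteDimensional.complete ℝ E
  intro e he
  obtain ⟨B, hB⟩ := exists_equiv_of_nondegenerate (G e) (h.nondegenerate e he)
  have h1 : ContDiffAt ℝ ∞ (ContinuousLinearMap.inverse (R := ℝ) (M := E) (M₂ := E →L[ℝ] ℝ)) (G e) :=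
    hB ▸ contDiffAt_map_inverse B
  exact h1.comp_contDiffWithinAt e (h.contDiffOn e he)

theorem contDiffOn_christoffel (h : IsMetricOn G U) : ContDiffOn ℝ ∞ (christoffel G) U := by
  refine contDiffOn_clm_apply.2 fun u => contDiffOn_clm_apply.2 fun v => ?_
  have h1 : ContDiffOn ℝ ∞ (fun e => christoffelFirst G e u v) U := by
    refine contDiffOn_clm_apply.2 fun w => ?_
    simp only [christoffelFirst_apply]
    have h2 := fun u v w => ((h.contDiffOn_fderiv.clm_apply (contDiffOn_const (c := u))).clm_apply
      (contDiffOn_const (c := v))).clm_apply (contDiffOn_const (c := w))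
    exact contDiffOn_const.mul (((h2 u v w).add (h2 v u w)).sub (h2 w u v))
  simp only [christoffel_apply]
  exact h.contDiffOn_sharp.clm_apply h1

theorem differentiableAt_christoffel (h : IsMetricOn G U) (he : e ∈ U) :
    DifferentiableAt ℝ (christoffel G) e :=
  differentiableAt_of_contDiffOn h.isOpen h.contDiffOn_christoffel he

theorem fderiv_christoffel_apply_apply (h : IsMetricOn G U) (he : e ∈ U) (u v w : E) :
    fderiv ℝ (fun e' => christoffel G e' v w) e u = fderiv ℝ (christoffel G) e u v w := by
  have h1 := ((h.differentiableAt_christoffel he).hasFDerivAt.clm_apply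
    (hasFDerivAt_const v e)).clm_apply (hasFDerivAt_const w e)
  rw [h1.fderiv]
  simp

/-- Nondegeneracy lets vectors be compared through their pairings with the metric; there the Koszul
expression is visibly symmetric in `u`, `v`. -/
theorem christoffel_symm (h : IsMetricOn G U) (he : e ∈ U) (u v : E) :
    christoffel G e u v = christoffel G e v u := by
  refine h.ext_of_apply he fun w => ?_
  rw [h.apply_christoffel he, h.apply_christoffel he, christoffelFirst_apply,
    christoffelFirst_apply, h.fderiv_symm he w u v]
  ring

/-- The Levi-Civita connection is metric. -/
theorem fderiv_eq_christoffel (h : IsMetricOn G U) (he : e ∈ U) (u v w : E) :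
    fderiv ℝ G e u v w = G e (christoffel G e u v) w + G e v (christoffel G e u w) := by
  rw [h.symm e he v, h.apply_christoffel he, h.apply_christoffel he, christoffelFirst_apply,
    christoffelFirst_apply, h.fderiv_symm he v u w, h.fderiv_symm he w u v, h.fderiv_symm he u w v]
  ring

theorem fderiv_christoffel_symm (h : IsMetricOn G U) (he : e ∈ U) (u v w : E) :
    fderiv ℝ (christoffel G) e u v w = fderiv ℝ (christoffel G) e u w v := by
  rw [← h.fderiv_christoffel_apply_apply he, ← h.fderiv_christoffel_apply_apply he]
  have : (fun e' => christoffel G e' v w) =ᶠ[nhds e] fun e' => christoffel G e' w v := by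
    filter_upwards [h.isOpen.mem_nhds he] with e' he' using h.christoffel_symm he' v w
  rw [this.fderiv_eq]

/-- The first Bianchi identity. -/
theorem curvature_cyclic (h : IsMetricOn G U) (he : e ∈ U) (u v w : E) :
    curvature G e u v w + curvature G e v w u + curvature G e w u v = 0 := by
  simp only [curvature]
  rw [h.fderiv_christoffel_symm he u w v, h.fderiv_christoffel_symm he v u w,
    h.fderiv_christoffel_symm he w v u, h.christoffel_symm he w v, h.christoffel_symm he u w,
    h.christoffel_symm he v u]
  abel

/-- The derivative of the metric compatibility identity, the input for the skewness of the
curvature. -/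
theorem fderiv_fderiv_apply (h : IsMetricOn G U) (he : e ∈ U) (x u v w : E) :
    fderiv ℝ (fderiv ℝ G) e x u v w
      = fderiv ℝ G e x (christoffel G e u v) w + G e (fderiv ℝ (christoffel G) e x u v) w
        + (fderiv ℝ G e x v (christoffel G e u w) + G e v (fderiv ℝ (christoffel G) e x u w)) := by
  have h1 := ((((differentiableAt_of_contDiffOn h.isOpen h.contDiffOn_fderiv he).hasFDerivAt.clm_apply
    (hasFDerivAt_const u e)).clm_apply (hasFDerivAt_const v e)).clm_apply (hasFDerivAt_const w e))
  have hG := (h.differentiableAt he).hasFDerivAt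
  have hΓ := fun v => ((h.differentiableAt_christoffel he).hasFDerivAt.clm_apply
    (hasFDerivAt_const u e)).clm_apply (hasFDerivAt_const v e)
  have h2 := (((hG.clm_apply (hΓ v)).clm_apply (hasFDerivAt_const w e))).add
    ((hG.clm_apply (hasFDerivAt_const v e)).clm_apply (hΓ w))
  have h3 : (fun e' => fderiv ℝ G e' u v w) =ᶠ[nhds e]
      ((fun e' => G e' (christoffel G e' u v) w) + fun e' => G e' v (christoffel G e' u w)) := by
    filter_upwards [h.isOpen.mem_nhds he] with e' he' using h.fderiv_eq_christoffel he' u v w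
  have h4 := congrArg (fun α : E →L[ℝ] ℝ => α x) (h1.unique (h2.congr_of_eventuallyEq h3))
  simpa [add_comm] using h4

/-- Second derivatives of the metric commute. Expanding both orders by metric compatibility, the
cross terms pairing two Christoffel vectors cancel, and what remains is the sum of the two curvature
pairings. -/
theorem curvature_skew (h : IsMetricOn G U) (he : e ∈ U) (u v w z : E) :
    G e (curvature G e u v w) z = - G e (curvature G e u v z) w := by
  have hs : fderiv ℝ (fderiv ℝ G) e u v = fderiv ℝ (fderiv ℝ G) e v u :=
    (isSymmSndFDerivAt_of_contDiffOn h.isOpen h.contDiffOn he).eq u v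
  have h1 := h.fderiv_fderiv_apply he u v w z
  have h2 := h.fderiv_fderiv_apply he v u w z
  rw [hs] at h1
  have h3 := h1.symm.trans h2
  simp only [h.fderiv_eq_christoffel he] at h3
  rw [h.symm e he w, h.symm e he w, h.symm e he w, h.symm e he w] at h3
  simp only [curvature, map_add, map_sub, add_apply, sub_apply]
  linarith

/-- A linear map that is skew with respect to a nondegenerate form has trace zero. -/
theorem trace_eq_zero_of_skew (h : IsMetricOn G U) (he : e ∈ U) (A : E →ₗ[ℝ] E)
    (hA : ∀ v w, G e (A v) w = - G e (A w) v) : LinearMap.trace ℝ E A = 0 := by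
  obtain ⟨B, hB⟩ := exists_equiv_of_nondegenerate (G e) (h.nondegenerate e he)
  let C : E ≃ₗ[ℝ] Module.Dual ℝ E :=
    B.toLinearEquiv.trans (LinearMap.toContinuousLinearMap (𝕜 := ℝ) (E := E) (F' := ℝ)).symm
  have hC : ∀ v w, C v w = G e v w := fun v w => by rw [← hB]; rfl
  -- Lowering the index turns skewness into `A` being conjugate to minus its transpose, so the trace
  -- equals its own negative.
  have h1 : C.conj A = - Module.Dual.transpose A := by
    ext α w
    obtain ⟨v, rfl⟩ := C.surjective α
    simp [LinearEquiv.conj_apply, Module.Dual.transpose_apply, hC, hA v w, h.symm e he v]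
  have h2 := LinearMap.trace_conj' A C
  rw [h1, map_neg, LinearMap.trace_transpose'] at h2
  linarith

/-- By the first Bianchi identity the difference of the two sides is the trace of $-R(v,w)$, a skew
endomorphism. -/
theorem ricci_symm (h : IsMetricOn G U) (he : e ∈ U) (v w : E) :
    ricci G e v w = ricci G e w v := by
  let A : E →ₗ[ℝ] E := curvatureMap G e v w - curvatureMap G e w v
  have hA : ∀ u, A u = - curvature G e v w u := fun u => by
    have h1 := h.curvature_cyclic he u v w
    have h2 : curvature G e w u v = - curvature G e u w v := by simp only [curvature]; abel
    rw [h2] at h1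
    have h3 : A u = curvature G e u v w - curvature G e u w v := rfl
    rw [h3, eq_neg_iff_add_eq_zero, ← h1]
    abel
  have h0 := h.trace_eq_zero_of_skew he A fun x y => by
    rw [hA, hA, map_neg, neg_apply, h.curvature_skew he, map_neg, neg_apply]
  rw [map_sub, ← ricci_eq, ← ricci_eq] at h0
  linarith

theorem contDiffOn_ricci (h : IsMetricOn G U) (v w : E) :
    ContDiffOn ℝ ∞ (fun e => ricci G e v w) U := by
  let b := Module.finBasis ℝ E
  have h1 : (fun e => ricci G e v w)
      = fun e => ∑ i, (LinearMap.toContinuousLinearMap (b.coord i)) (curvature G e (b i) v w) := by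
    ext e
    rw [ricci_eq, LinearMap.trace_eq_matrix_trace ℝ b]
    simp [Matrix.trace, LinearMap.toMatrix_apply, curvatureMap]
  rw [h1]
  refine ContDiffOn.sum fun i _ => (ContinuousLinearMap.contDiff _).comp_contDiffOn ?_
  have hΓ := h.contDiffOn_christoffel
  have hΓ' := fderiv_contDiffOn h.isOpen hΓ
  have c := fun u : E => (contDiffOn_const (c := u) (s := U) (𝕜 := ℝ) (n := ∞))
  simp only [curvature]
  exact (((((hΓ'.clm_apply (c _)).clm_apply (c _)).clm_apply (c _)).sub
    (((hΓ'.clm_apply (c _)).clm_apply (c _)).clm_apply (c _))).add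
    ((hΓ.clm_apply (c _)).clm_apply ((hΓ.clm_apply (c _)).clm_apply (c _)))).sub
    ((hΓ.clm_apply (c _)).clm_apply ((hΓ.clm_apply (c _)).clm_apply (c _)))

theorem hessian_symm (h : IsMetricOn G U) (hf : ContDiffOn ℝ ∞ f U) (he : e ∈ U) (v w : E) :
    hessian G f e v w = hessian G f e w v := by
  rw [hessian_apply, hessian_apply, h.christoffel_symm he,
    (isSymmSndFDerivAt_of_contDiffOn h.isOpen hf he).eq]

theorem contDiffOn_hessian (h : IsMetricOn G U) (hf : ContDiffOn ℝ ∞ f U) (v w : E) :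
    ContDiffOn ℝ ∞ (fun e => hessian G f e v w) U := by
  have hf' := fderiv_contDiffOn h.isOpen hf
  have hf'' := fderiv_contDiffOn h.isOpen hf'
  have c := fun u : E => (contDiffOn_const (c := u) (s := U) (𝕜 := ℝ) (n := ∞))
  simp only [hessian_apply]
  exact ((hf''.clm_apply (c _)).clm_apply (c _)).sub
    (hf'.clm_apply ((h.contDiffOn_christoffel.clm_apply (c _)).clm_apply (c _)))

theorem contDiffOn_gradient (h : IsMetricOn G U) (hf : ContDiffOn ℝ ∞ f U) :
    ContDiffOn ℝ ∞ (gradient G f) U :=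
  h.contDiffOn_sharp.clm_apply (fderiv_contDiffOn h.isOpen hf)

/-- The Hessian is the metric dual of the covariant derivative of the gradient. -/
theorem sharp_hessian (h : IsMetricOn G U) (hf : ContDiffOn ℝ ∞ f U) (he : e ∈ U) (v : E) :
    sharp (G e) (hessian G f e v)
      = fderiv ℝ (gradient G f) e v + christoffel G e v (gradient G f e) := by
  refine h.ext_of_apply he fun w => ?_
  rw [h.apply_sharp he, hessian_apply]
  have hG := (h.differentiableAt he).hasFDerivAt
  have hgr := (differentiableAt_of_contDiffOn h.isOpen (h.contDiffOn_gradient hf) he).hasFDerivAt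
  have h1 := (hG.clm_apply hgr).clm_apply (hasFDerivAt_const w e)
  have h2 := (differentiableAt_of_contDiffOn h.isOpen
    (fderiv_contDiffOn h.isOpen hf) he).hasFDerivAt.clm_apply (hasFDerivAt_const w e)
  -- The defining identity $df(w)=G(\nabla f,w)$ is differentiated along `v`.
  have h3 : (fun e' => fderiv ℝ f e' w) =ᶠ[nhds e] fun e' => G e' (gradient G f e') w := by
    filter_upwards [h.isOpen.mem_nhds he] with e' he' using (h.apply_gradient he' w).symm
  have h4 := congrArg (fun α : E →L[ℝ] ℝ => α v) (h2.unique (h1.congr_of_eventuallyEq h3))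
  simp only [ContinuousLinearMap.comp_zero, zero_add,
    ContinuousLinearMap.flip_apply, add_apply, ContinuousLinearMap.comp_apply] at h4
  rw [h4, h.fderiv_eq_christoffel he, h.apply_gradient he, map_add, add_apply]
  ring

/-- A Ricci tensor is Killing as soon as the associated cubic form vanishes. -/
theorem cyclic_sum_covDeriv_eq_zero (h : IsMetricOn G U) (he : e ∈ U)
    (h0 : ∀ u, covDeriv G (ricci G) e u u u = 0) (u v w : E) :
    covDeriv G (ricci G) e u v w + covDeriv G (ricci G) e v w u
      + covDeriv G (ricci G) e w u v = 0 := by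
  set T := covDeriv G (ricci G) e with hT
  have hs : ∀ u v w, T u v w = T u w v := fun u v w => by
    simp only [hT, covDeriv]
    have : (fun e' => ricci G e' v w) =ᶠ[nhds e] fun e' => ricci G e' w v := by
      filter_upwards [h.isOpen.mem_nhds he] with e' he' using h.ricci_symm he' v w
    rw [this.fderiv_eq, h.ricci_symm he _ w, h.ricci_symm he v]
    ring
  have hR : ∀ v v' w : E, ∀ e' ∈ U, ricci G e' w (v + v') = ricci G e' w v + ricci G e' w v' := by
    intro v v' w e' he'
    rw [h.ricci_symm he', ricci_add_left, h.ricci_symm he' v, h.ricci_symm he' v']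
  have hd : ∀ v w, DifferentiableAt ℝ (fun e' => ricci G e' v w) e := fun v w =>
    differentiableAt_of_contDiffOn h.isOpen (h.contDiffOn_ricci v w) he
  have h1 : ∀ u u' v w, T (u + u') v w = T u v w + T u' v w := fun u u' v w => by
    simp only [hT, covDeriv, map_add, add_apply, ricci_add_left, hR _ _ _ e he]
    ring
  have h2 : ∀ u v v' w, T u (v + v') w = T u v w + T u v' w := fun u v v' w => by
    simp only [hT, covDeriv, map_add, ricci_add_left]
    rw [fderiv_fun_add (hd _ _) (hd _ _), add_apply]
    ring
  have h3 : ∀ u v w w', T u v (w + w') = T u v w + T u v w' := fun u v w w' => by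
    rw [hs, h2, hs, hs u w']
  -- Polarization: inclusion–exclusion over these sums isolates the six mixed terms, which by
  -- symmetry in the last two slots are twice the cyclic sum.
  have huvw := h0 (u + v + w)
  have huv := h0 (u + v)
  have huw := h0 (u + w)
  have hvw := h0 (v + w)
  simp only [h1, h2, h3, h0] at huvw huv huw hvw
  have := hs u w v
  have := hs v w u
  have := hs w v u
  linarith

end IsMetricOn

end Metric

end Coord

namespace Coord

/-! ### Connection, curvature and Ricci tensor of a doubly warped product in coordinates. -/

section DoublyWarped

variable {E E₁ E₂ : Type*} [NormedAddCommGroup E] [NormedSpace ℝ E]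
  [NormedAddCommGroup E₁] [NormedSpace ℝ E₁] [NormedAddCommGroup E₂] [NormedSpace ℝ E₂]

/-- `E` is the direct sum of `E₁` and `E₂` with projections `p₁`, `p₂` and inclusions `i₁`, `i₂`,
and over `U₁ × U₂` the metric `G` is the doubly warped product `f₂² G₁ ⊕ f₁² G₂`. -/
structure IsDoublyWarpedOn (p₁ : E →L[ℝ] E₁) (p₂ : E →L[ℝ] E₂) (i₁ : E₁ →L[ℝ] E)
    (i₂ : E₂ →L[ℝ] E) (G₁ : E₁ → E₁ →L[ℝ] E₁ →L[ℝ] ℝ) (G₂ : E₂ → E₂ →L[ℝ] E₂ →L[ℝ] ℝ)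
    (f₁ : E₁ → ℝ) (f₂ : E₂ → ℝ) (U₁ : Set E₁) (U₂ : Set E₂)
    (G : E → E →L[ℝ] E →L[ℝ] ℝ) : Prop where
  fst_inl : ∀ x, p₁ (i₁ x) = x
  fst_inr : ∀ y, p₁ (i₂ y) = 0
  snd_inl : ∀ x, p₂ (i₁ x) = 0
  snd_inr : ∀ y, p₂ (i₂ y) = y
  inl_add_inr : ∀ z, i₁ (p₁ z) + i₂ (p₂ z) = z
  metric₁ : IsMetricOn G₁ U₁
  metric₂ : IsMetricOn G₂ U₂
  contDiffOn₁ : ContDiffOn ℝ ∞ f₁ U₁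
  contDiffOn₂ : ContDiffOn ℝ ∞ f₂ U₂
  pos₁ : ∀ x ∈ U₁, 0 < f₁ x
  pos₂ : ∀ y ∈ U₂, 0 < f₂ y
  apply_eq : ∀ e, p₁ e ∈ U₁ → p₂ e ∈ U₂ → ∀ v w, G e v w
    = f₂ (p₂ e) ^ 2 * G₁ (p₁ e) (p₁ v) (p₁ w) + f₁ (p₁ e) ^ 2 * G₂ (p₂ e) (p₂ v) (p₂ w)

variable {p₁ : E →L[ℝ] E₁} {p₂ : E →L[ℝ] E₂} {i₁ : E₁ →L[ℝ] E}
    {i₂ : E₂ →L[ℝ] E} {G₁ : E₁ → E₁ →L[ℝ] E₁ →L[ℝ] ℝ} {G₂ : E₂ → E₂ →L[ℝ] E₂ →L[ℝ] ℝ}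
    {f₁ : E₁ → ℝ} {f₂ : E₂ → ℝ} {U₁ : Set E₁} {U₂ : Set E₂}
    {G : E → E →L[ℝ] E →L[ℝ] ℝ} {e : E}

namespace IsDoublyWarpedOn

/-- The structure is symmetric in the two factors. Abstract projections and inclusions, in place of
a literal product, allow every horizontal formula to be reused vertically. -/
theorem swap (d : IsDoublyWarpedOn p₁ p₂ i₁ i₂ G₁ G₂ f₁ f₂ U₁ U₂ G) :
    IsDoublyWarpedOn p₂ p₁ i₂ i₁ G₂ G₁ f₂ f₁ U₂ U₁ G where
  fst_inl := d.snd_inr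
  fst_inr := d.snd_inl
  snd_inl := d.fst_inr
  snd_inr := d.fst_inl
  inl_add_inr z := by rw [add_comm, d.inl_add_inr]
  metric₁ := d.metric₂
  metric₂ := d.metric₁
  contDiffOn₁ := d.contDiffOn₂
  contDiffOn₂ := d.contDiffOn₁
  pos₁ := d.pos₂
  pos₂ := d.pos₁
  apply_eq e h₁ h₂ v w := by rw [d.apply_eq e h₂ h₁, add_comm]

theorem hasFDerivAt₁ (d : IsDoublyWarpedOn p₁ p₂ i₁ i₂ G₁ G₂ f₁ f₂ U₁ U₂ G)
    {x : E₁} (hx : x ∈ U₁) : HasFDerivAt f₁ (fderiv ℝ f₁ x) x :=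
  (differentiableAt_of_contDiffOn d.metric₁.isOpen d.contDiffOn₁ hx).hasFDerivAt

/-- Chain rule along the affine slice through `e` with the second coordinate frozen: a formula valid
on this slice alone suffices to differentiate horizontally. -/
theorem fderiv_inl {F : Type*} [NormedAddCommGroup F] [NormedSpace ℝ F] {Φ : E → F} {φ : E₁ → F}
    (d : IsDoublyWarpedOn p₁ p₂ i₁ i₂ G₁ G₂ f₁ f₂ U₁ U₂ G) (h₁ : p₁ e ∈ U₁)
    (hΦ : DifferentiableAt ℝ Φ e) (hφ : ∀ x ∈ U₁, Φ (i₁ x + i₂ (p₂ e)) = φ x) (x : E₁) :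
    fderiv ℝ Φ e (i₁ x) = fderiv ℝ φ (p₁ e) x := by
  have hc : HasFDerivAt (fun x => i₁ x + i₂ (p₂ e)) i₁ (p₁ e) := i₁.hasFDerivAt.add_const _
  have hΦ' := hΦ.hasFDerivAt
  rw [← d.inl_add_inr e] at hΦ'
  have h := hΦ'.comp (p₁ e) hc
  rw [d.inl_add_inr e] at h
  have hev : φ =ᶠ[nhds (p₁ e)] Φ ∘ fun x => i₁ x + i₂ (p₂ e) := by
    filter_upwards [d.metric₁.isOpen.mem_nhds h₁] with x hx using (hφ x hx).symm
  rw [hev.fderiv_eq, h.fderiv]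
  rfl

variable [FiniteDimensional ℝ E]

theorem isMetricOn (d : IsDoublyWarpedOn p₁ p₂ i₁ i₂ G₁ G₂ f₁ f₂ U₁ U₂ G) :
    IsMetricOn G (p₁ ⁻¹' U₁ ∩ p₂ ⁻¹' U₂) where
  isOpen := (d.metric₁.isOpen.preimage p₁.continuous).inter
    (d.metric₂.isOpen.preimage p₂.continuous)
  symm e he v w := by
    rw [d.apply_eq e he.1 he.2, d.apply_eq e he.1 he.2, d.metric₁.symm _ he.1,
      d.metric₂.symm _ he.2]
  nondegenerate e he v hv := by
    have h₁ : p₁ v = 0 := d.metric₁.nondegenerate _ he.1 _ fun w => by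
      have := hv (i₁ w)
      rw [d.apply_eq e he.1 he.2, d.fst_inl, d.snd_inl] at this
      simpa [(d.pos₂ _ he.2).ne'] using this
    have h₂ : p₂ v = 0 := d.metric₂.nondegenerate _ he.2 _ fun w => by
      have := hv (i₂ w)
      rw [d.apply_eq e he.1 he.2, d.fst_inr, d.snd_inr] at this
      simpa [(d.pos₁ _ he.1).ne'] using this
    rw [← d.inl_add_inr v, h₁, h₂, map_zero, map_zero, add_zero]
  contDiffOn := by
    refine contDiffOn_clm_apply.2 fun v => contDiffOn_clm_apply.2 fun w => ?_
    have h₁ : Set.MapsTo p₁ (p₁ ⁻¹' U₁ ∩ p₂ ⁻¹' U₂) U₁ := fun e he => he.1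
    have h₂ : Set.MapsTo p₂ (p₁ ⁻¹' U₁ ∩ p₂ ⁻¹' U₂) U₂ := fun e he => he.2
    have hf₁ := d.contDiffOn₁.comp p₁.contDiff.contDiffOn h₁
    have hf₂ := d.contDiffOn₂.comp p₂.contDiff.contDiffOn h₂
    have hG₁ := ((d.metric₁.contDiffOn.comp p₁.contDiff.contDiffOn h₁).clm_apply
      (contDiffOn_const (c := p₁ v))).clm_apply (contDiffOn_const (c := p₁ w))
    have hG₂ := ((d.metric₂.contDiffOn.comp p₂.contDiff.contDiffOn h₂).clm_apply
      (contDiffOn_const (c := p₂ v))).clm_apply (contDiffOn_const (c := p₂ w))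
    exact (((hf₂.pow 2).mul hG₁).add ((hf₁.pow 2).mul hG₂)).congr
      fun e he => d.apply_eq e he.1 he.2 v w

theorem fderiv_apply (d : IsDoublyWarpedOn p₁ p₂ i₁ i₂ G₁ G₂ f₁ f₂ U₁ U₂ G)
    (h₁ : p₁ e ∈ U₁) (h₂ : p₂ e ∈ U₂) (u v w : E) :
    fderiv ℝ G e u v w
      = 2 * f₂ (p₂ e) * fderiv ℝ f₂ (p₂ e) (p₂ u) * G₁ (p₁ e) (p₁ v) (p₁ w)
        + f₂ (p₂ e) ^ 2 * fderiv ℝ G₁ (p₁ e) (p₁ u) (p₁ v) (p₁ w)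
        + 2 * f₁ (p₁ e) * fderiv ℝ f₁ (p₁ e) (p₁ u) * G₂ (p₂ e) (p₂ v) (p₂ w)
        + f₁ (p₁ e) ^ 2 * fderiv ℝ G₂ (p₂ e) (p₂ u) (p₂ v) (p₂ w) := by
  have he : e ∈ p₁ ⁻¹' U₁ ∩ p₂ ⁻¹' U₂ := ⟨h₁, h₂⟩
  have hf₁ := (d.hasFDerivAt₁ h₁).comp e p₁.hasFDerivAt
  have hf₂ := (d.swap.hasFDerivAt₁ h₂).comp e p₂.hasFDerivAt
  have hG₁ := (((d.metric₁.differentiableAt h₁).hasFDerivAt.comp e p₁.hasFDerivAt).clm_apply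
    (hasFDerivAt_const (p₁ v) e)).clm_apply (hasFDerivAt_const (p₁ w) e)
  have hG₂ := (((d.metric₂.differentiableAt h₂).hasFDerivAt.comp e p₂.hasFDerivAt).clm_apply
    (hasFDerivAt_const (p₂ v) e)).clm_apply (hasFDerivAt_const (p₂ w) e)
  have h := ((hf₂.pow 2).mul hG₁).add ((hf₁.pow 2).mul hG₂)
  rw [← d.isMetricOn.fderiv_apply_apply he, (h.congr_of_eventuallyEq (f₁ := fun e' => G e' v w)
    (by filter_upwards [d.isMetricOn.isOpen.mem_nhds he] with e' he' using
      d.apply_eq e' he'.1 he'.2 v w)).fderiv]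
  simp
  ring

theorem christoffel_inl_inr (d : IsDoublyWarpedOn p₁ p₂ i₁ i₂ G₁ G₂ f₁ f₂ U₁ U₂ G)
    (h₁ : p₁ e ∈ U₁) (h₂ : p₂ e ∈ U₂) (x : E₁) (y : E₂) :
    christoffel G e (i₁ x) (i₂ y) = (fderiv ℝ f₂ (p₂ e) y / f₂ (p₂ e)) • i₁ x
      + (fderiv ℝ f₁ (p₁ e) x / f₁ (p₁ e)) • i₂ y := by
  have he : e ∈ p₁ ⁻¹' U₁ ∩ p₂ ⁻¹' U₂ := ⟨h₁, h₂⟩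
  refine d.isMetricOn.ext_of_apply he fun w => ?_
  have := (d.pos₁ _ h₁).ne'
  have := (d.pos₂ _ h₂).ne'
  rw [d.isMetricOn.apply_christoffel he, christoffelFirst_apply, d.apply_eq e h₁ h₂]
  simp only [d.fderiv_apply h₁ h₂, map_add, map_smul, add_apply, smul_apply, smul_eq_mul,
    d.fst_inl, d.fst_inr, d.snd_inl, d.snd_inr, map_zero, zero_apply]
  field_simp
  ring

theorem christoffel_inr_inl (d : IsDoublyWarpedOn p₁ p₂ i₁ i₂ G₁ G₂ f₁ f₂ U₁ U₂ G)
    (h₁ : p₁ e ∈ U₁) (h₂ : p₂ e ∈ U₂) (x : E₁) (y : E₂) :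
    christoffel G e (i₂ y) (i₁ x) = (fderiv ℝ f₂ (p₂ e) y / f₂ (p₂ e)) • i₁ x
      + (fderiv ℝ f₁ (p₁ e) x / f₁ (p₁ e)) • i₂ y := by
  rw [d.isMetricOn.christoffel_symm ⟨h₁, h₂⟩, d.christoffel_inl_inr h₁ h₂]

theorem map_fderiv_christoffel_inl {F : Type*} [NormedAddCommGroup F] [NormedSpace ℝ F]
    {φ : E₁ → F} (d : IsDoublyWarpedOn p₁ p₂ i₁ i₂ G₁ G₂ f₁ f₂ U₁ U₂ G)
    (h₁ : p₁ e ∈ U₁) (h₂ : p₂ e ∈ U₂) (P : E →L[ℝ] F) (v w : E)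
    (hφ : ∀ x ∈ U₁, P (christoffel G (i₁ x + i₂ (p₂ e)) v w) = φ x) (x : E₁) :
    P (fderiv ℝ (christoffel G) e (i₁ x) v w) = fderiv ℝ φ (p₁ e) x := by
  have hΓ := ((d.isMetricOn.differentiableAt_christoffel ⟨h₁, h₂⟩).hasFDerivAt.clm_apply
    (hasFDerivAt_const v e)).clm_apply (hasFDerivAt_const w e)
  have h := P.hasFDerivAt.comp e hΓ
  rw [← d.fderiv_inl h₁ h.differentiableAt hφ, h.fderiv]
  simp

theorem map_fderiv_christoffel_inr {F : Type*} [NormedAddCommGroup F] [NormedSpace ℝ F]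
    {φ : E₂ → F} (d : IsDoublyWarpedOn p₁ p₂ i₁ i₂ G₁ G₂ f₁ f₂ U₁ U₂ G)
    (h₁ : p₁ e ∈ U₁) (h₂ : p₂ e ∈ U₂) (P : E →L[ℝ] F) (v w : E)
    (hφ : ∀ y ∈ U₂, P (christoffel G (i₁ (p₁ e) + i₂ y) v w) = φ y) (y : E₂) :
    P (fderiv ℝ (christoffel G) e (i₂ y) v w) = fderiv ℝ φ (p₂ e) y :=
  d.swap.map_fderiv_christoffel_inl h₂ h₁ P v w (fun y hy => by rw [add_comm, hφ y hy]) y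

variable [FiniteDimensional ℝ E₁] [FiniteDimensional ℝ E₂]

/-- The vertical term comes from differentiating the factor $f_2^2$ in front of $g_1$; the division
by $f_1^2$ comes from raising the index with $f_1^2g_2$. -/
theorem christoffel_inl_inl (d : IsDoublyWarpedOn p₁ p₂ i₁ i₂ G₁ G₂ f₁ f₂ U₁ U₂ G)
    (h₁ : p₁ e ∈ U₁) (h₂ : p₂ e ∈ U₂) (x y : E₁) :
    christoffel G e (i₁ x) (i₁ y) = i₁ (christoffel G₁ (p₁ e) x y)
      - (f₂ (p₂ e) / f₁ (p₁ e) ^ 2 * G₁ (p₁ e) x y) • i₂ (gradient G₂ f₂ (p₂ e)) := by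
  have he : e ∈ p₁ ⁻¹' U₁ ∩ p₂ ⁻¹' U₂ := ⟨h₁, h₂⟩
  refine d.isMetricOn.ext_of_apply he fun w => ?_
  have := (d.pos₁ _ h₁).ne'
  rw [d.isMetricOn.apply_christoffel he, christoffelFirst_apply, d.apply_eq e h₁ h₂]
  simp only [d.fderiv_apply h₁ h₂, map_sub, map_smul, sub_apply, smul_apply, smul_eq_mul,
    d.fst_inl, d.fst_inr, d.snd_inl, d.snd_inr, d.metric₁.apply_christoffel h₁,
    d.metric₂.apply_gradient h₂, christoffelFirst_apply, map_zero, zero_apply]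
  field_simp
  ring

/-- The horizontal part of `R(U, X) Y` for horizontal vectors. -/
theorem fst_curvature_inl_inl_inl (d : IsDoublyWarpedOn p₁ p₂ i₁ i₂ G₁ G₂ f₁ f₂ U₁ U₂ G)
    (h₁ : p₁ e ∈ U₁) (h₂ : p₂ e ∈ U₂) (u x y : E₁) :
    p₁ (curvature G e (i₁ u) (i₁ x) (i₁ y)) = curvature G₁ (p₁ e) u x y
      - (fderiv ℝ f₂ (p₂ e) (gradient G₂ f₂ (p₂ e)) / f₁ (p₁ e) ^ 2)
        • (G₁ (p₁ e) x y • u - G₁ (p₁ e) u y • x) := by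
  have hd : ∀ u x y, p₁ (fderiv ℝ (christoffel G) e (i₁ u) (i₁ x) (i₁ y))
      = fderiv ℝ (christoffel G₁) (p₁ e) u x y := fun u x y => by
    rw [← d.metric₁.fderiv_christoffel_apply_apply h₁]
    refine d.map_fderiv_christoffel_inl h₁ h₂ _ _ _ (fun z hz => ?_) u
    rw [d.christoffel_inl_inl] <;>
      simp [d.fst_inl, d.fst_inr, d.snd_inl, d.snd_inr, hz, h₂]
  have := (d.pos₁ _ h₁).ne'
  have := (d.pos₂ _ h₂).ne'
  simp only [curvature, map_add, map_sub, hd]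
  rw [d.christoffel_inl_inl h₁ h₂, d.christoffel_inl_inl h₁ h₂]
  simp only [map_sub, map_smul, d.christoffel_inl_inl h₁ h₂, d.christoffel_inl_inr h₁ h₂, map_add,
    d.fst_inl, d.fst_inr]
  match_scalars <;> field_simp

/-- The vertical part of `R(V, X) Y` for a vertical vector `V` and horizontal `X`, `Y`. -/
theorem snd_curvature_inr_inl_inl (d : IsDoublyWarpedOn p₁ p₂ i₁ i₂ G₁ G₂ f₁ f₂ U₁ U₂ G)
    (h₁ : p₁ e ∈ U₁) (h₂ : p₂ e ∈ U₂) (v : E₂) (x y : E₁) :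
    p₂ (curvature G e (i₂ v) (i₁ x) (i₁ y))
      = -(G₁ (p₁ e) x y / f₁ (p₁ e) ^ 2 * f₂ (p₂ e))
          • sharp (G₂ (p₂ e)) (hessian G₂ f₂ (p₂ e) v)
        - (hessian G₁ f₁ (p₁ e) x y / f₁ (p₁ e)) • v := by
  have n₁ := (d.pos₁ _ h₁).ne'
  have n₂ := (d.pos₂ _ h₂).ne'
  -- Only $f_2\nabla f_2$ varies in the vertical direction; the derivative of the gradient later
  -- combines with a Christoffel term into the Hessian.
  have hd₁ : p₂ (fderiv ℝ (christoffel G) e (i₂ v) (i₁ x) (i₁ y))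
      = -(G₁ (p₁ e) x y / f₁ (p₁ e) ^ 2) • (f₂ (p₂ e) • fderiv ℝ (gradient G₂ f₂) (p₂ e) v
        + fderiv ℝ f₂ (p₂ e) v • gradient G₂ f₂ (p₂ e)) := by
    have hgr := (differentiableAt_of_contDiffOn d.metric₂.isOpen
      (d.metric₂.contDiffOn_gradient d.contDiffOn₂) h₂).hasFDerivAt
    have h := ((d.swap.hasFDerivAt₁ h₂).smul hgr).const_smul (-(G₁ (p₁ e) x y / f₁ (p₁ e) ^ 2))
    have := d.map_fderiv_christoffel_inr h₁ h₂ p₂ (i₁ x) (i₁ y)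
      (φ := fun z => -(G₁ (p₁ e) x y / f₁ (p₁ e) ^ 2) • (f₂ z • gradient G₂ f₂ z))
      (fun z hz => by
        rw [d.christoffel_inl_inl] <;>
          simp only [map_sub, map_smul, map_add, d.fst_inl, d.fst_inr, d.snd_inl, d.snd_inr, hz, h₁,
            add_zero, zero_add]
        match_scalars
        field_simp) v
    rw [this]
    erw [h.fderiv]
    simp
  have hd₂ : p₂ (fderiv ℝ (christoffel G) e (i₁ x) (i₂ v) (i₁ y))
      = ((fderiv ℝ (fderiv ℝ f₁) (p₁ e) x y * f₁ (p₁ e)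
          - fderiv ℝ f₁ (p₁ e) y * fderiv ℝ f₁ (p₁ e) x) / f₁ (p₁ e) ^ 2) • v := by
    have hf' := (differentiableAt_of_contDiffOn d.metric₁.isOpen
      (fderiv_contDiffOn d.metric₁.isOpen d.contDiffOn₁) h₁).hasFDerivAt.clm_apply
      (hasFDerivAt_const y (p₁ e))
    have h := (hasFDerivAt_div hf' (d.hasFDerivAt₁ h₁) n₁).smul_const v
    have := d.map_fderiv_christoffel_inl h₁ h₂ p₂ (i₂ v) (i₁ y)
      (φ := fun z => (fderiv ℝ f₁ z y / f₁ z) • v)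
      (fun z hz => by
        rw [d.christoffel_inr_inl] <;>
          simp [d.fst_inl, d.fst_inr, d.snd_inl, d.snd_inr, hz, h₂]) x
    rw [this]
    erw [h.fderiv]
    simp
    match_scalars
    field_simp
  simp only [curvature, map_add, map_sub, hd₁, hd₂]
  rw [d.christoffel_inl_inl h₁ h₂, d.christoffel_inr_inl h₁ h₂, hessian_apply,
    d.metric₂.sharp_hessian d.contDiffOn₂ h₂]
  simp only [map_sub, map_add, map_smul, d.christoffel_inl_inl h₁ h₂, d.christoffel_inl_inr h₁ h₂,
    d.christoffel_inr_inl h₁ h₂, d.swap.christoffel_inl_inl h₂ h₁,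
    d.snd_inl, d.snd_inr]
  match_scalars <;> field_simp <;> ring

/-- The relevant Christoffel components are constant along the leaf, so only products of Christoffel
symbols contribute, and their $\Gamma_1$ parts cancel by symmetry. -/
theorem fst_curvature_inl_inl_inr (d : IsDoublyWarpedOn p₁ p₂ i₁ i₂ G₁ G₂ f₁ f₂ U₁ U₂ G)
    (h₁ : p₁ e ∈ U₁) (h₂ : p₂ e ∈ U₂) (u x : E₁) (w : E₂) :
    p₁ (curvature G e (i₁ u) (i₁ x) (i₂ w)) = (fderiv ℝ f₂ (p₂ e) w / f₂ (p₂ e)) •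
      ((fderiv ℝ f₁ (p₁ e) x / f₁ (p₁ e)) • u - (fderiv ℝ f₁ (p₁ e) u / f₁ (p₁ e)) • x) := by
  have hd : ∀ u x, p₁ (fderiv ℝ (christoffel G) e (i₁ u) (i₁ x) (i₂ w)) = 0 := fun u x => by
    rw [d.map_fderiv_christoffel_inl h₁ h₂ p₁ (i₁ x) (i₂ w)
      (φ := fun _ => (fderiv ℝ f₂ (p₂ e) w / f₂ (p₂ e)) • x) (fun z hz => by
        rw [d.christoffel_inl_inr] <;>
          simp [d.fst_inl, d.fst_inr, d.snd_inl, d.snd_inr, hz, h₂])]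
    simp
  simp only [curvature, map_add, map_sub, hd]
  simp only [map_add, map_smul, d.christoffel_inl_inl h₁ h₂, d.christoffel_inl_inr h₁ h₂, map_sub,
    d.fst_inl, d.fst_inr, d.metric₁.christoffel_symm h₁ x u]
  module

theorem snd_curvature_inr_inl_inr (d : IsDoublyWarpedOn p₁ p₂ i₁ i₂ G₁ G₂ f₁ f₂ U₁ U₂ G)
    (h₁ : p₁ e ∈ U₁) (h₂ : p₂ e ∈ U₂) (v w : E₂) (x : E₁) :
    p₂ (curvature G e (i₂ v) (i₁ x) (i₂ w)) = (fderiv ℝ f₁ (p₁ e) x / f₁ (p₁ e)) •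
      ((fderiv ℝ f₂ (p₂ e) w / f₂ (p₂ e)) • v
        - (G₂ (p₂ e) v w / f₂ (p₂ e)) • gradient G₂ f₂ (p₂ e)) := by
  have n₁ := (d.pos₁ _ h₁).ne'
  have n₂ := (d.pos₂ _ h₂).ne'
  have hd₁ : p₂ (fderiv ℝ (christoffel G) e (i₂ v) (i₁ x) (i₂ w)) = 0 := by
    rw [d.map_fderiv_christoffel_inr h₁ h₂ p₂ (i₁ x) (i₂ w)
      (φ := fun _ => (fderiv ℝ f₁ (p₁ e) x / f₁ (p₁ e)) • w) (fun z hz => by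
        rw [d.christoffel_inl_inr] <;>
          simp [d.fst_inl, d.fst_inr, d.snd_inl, d.snd_inr, hz, h₁])]
    simp
  have hd₂ : p₂ (fderiv ℝ (christoffel G) e (i₁ x) (i₂ v) (i₂ w)) = 0 := by
    rw [d.map_fderiv_christoffel_inl h₁ h₂ p₂ (i₂ v) (i₂ w)
      (φ := fun _ => christoffel G₂ (p₂ e) v w) (fun z hz => by
        rw [d.swap.christoffel_inl_inl] <;>
          simp [d.fst_inl, d.fst_inr, d.snd_inl, d.snd_inr, hz, h₂])]
    simp
  simp only [curvature, map_add, map_sub, hd₁, hd₂]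
  rw [d.swap.christoffel_inl_inl h₂ h₁, d.christoffel_inl_inr h₁ h₂]
  simp only [map_sub, map_add, map_smul, d.christoffel_inl_inl h₁ h₂, d.christoffel_inl_inr h₁ h₂,
    d.christoffel_inr_inl h₁ h₂, d.swap.christoffel_inl_inl h₂ h₁,
    d.snd_inl, d.snd_inr, d.metric₁.symm _ h₁ x, d.metric₁.apply_gradient h₁]
  match_scalars <;> field_simp <;> ring

/-- Cyclicity of the trace applied to $\mathrm{id}=i_1p_1+i_2p_2$. For the Ricci tensor, therefore,
only the diagonal blocks of the curvature are ever needed. -/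
theorem trace_eq (d : IsDoublyWarpedOn p₁ p₂ i₁ i₂ G₁ G₂ f₁ f₂ U₁ U₂ G)
    (A : E →ₗ[ℝ] E) : LinearMap.trace ℝ E A
      = LinearMap.trace ℝ E₁ ((p₁ : E →ₗ[ℝ] E₁) ∘ₗ A ∘ₗ (i₁ : E₁ →ₗ[ℝ] E))
        + LinearMap.trace ℝ E₂ ((p₂ : E →ₗ[ℝ] E₂) ∘ₗ A ∘ₗ (i₂ : E₂ →ₗ[ℝ] E)) := by
  rw [LinearMap.trace_comp_comm', LinearMap.trace_comp_comm' _ (p₂ : E →ₗ[ℝ] E₂), ← map_add]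
  congr 1
  ext v
  simp only [LinearMap.add_apply, LinearMap.comp_apply, ContinuousLinearMap.coe_coe, ← map_add,
    d.inl_add_inr]

/-- In the horizontal block, the identity minus a rank-one map gives the factor $n_1-1$. The
vertical block gives the Laplacian of $f_2$ and, from a multiple of the identity, the factor $n_2$.
-/
theorem ricci_inl_inl (d : IsDoublyWarpedOn p₁ p₂ i₁ i₂ G₁ G₂ f₁ f₂ U₁ U₂ G)
    (h₁ : p₁ e ∈ U₁) (h₂ : p₂ e ∈ U₂) (x y : E₁) :
    ricci G e (i₁ x) (i₁ y) = ricci G₁ (p₁ e) x y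
      - Module.finrank ℝ E₂ / f₁ (p₁ e) * hessian G₁ f₁ (p₁ e) x y
      - G₁ (p₁ e) x y / f₁ (p₁ e) ^ 2 * (f₂ (p₂ e) * laplacian G₂ f₂ (p₂ e)
        + ((Module.finrank ℝ E₁ : ℝ) - 1)
          * fderiv ℝ f₂ (p₂ e) (gradient G₂ f₂ (p₂ e))) := by
  have hA₁ : (p₁ : E →ₗ[ℝ] E₁) ∘ₗ curvatureMap G e (i₁ x) (i₁ y) ∘ₗ (i₁ : E₁ →ₗ[ℝ] E)
      = curvatureMap G₁ (p₁ e) x y - (fderiv ℝ f₂ (p₂ e) (gradient G₂ f₂ (p₂ e)) / f₁ (p₁ e) ^ 2)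
        • (G₁ (p₁ e) x y • LinearMap.id - ((G₁ (p₁ e) y : E₁ →ₗ[ℝ] ℝ)).smulRight x) := by
    ext u
    refine (d.fst_curvature_inl_inl_inl h₁ h₂ u x y).trans ?_
    simp [curvatureMap, d.metric₁.symm _ h₁ y u]
  have hA₂ : (p₂ : E →ₗ[ℝ] E₂) ∘ₗ curvatureMap G e (i₁ x) (i₁ y) ∘ₗ (i₂ : E₂ →ₗ[ℝ] E)
      = -(G₁ (p₁ e) x y / f₁ (p₁ e) ^ 2 * f₂ (p₂ e))
          • ((sharp (G₂ (p₂ e)) ∘L hessian G₂ f₂ (p₂ e) : E₂ →L[ℝ] E₂) : E₂ →ₗ[ℝ] E₂)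
        - (hessian G₁ f₁ (p₁ e) x y / f₁ (p₁ e)) • LinearMap.id := by
    ext v
    exact d.snd_curvature_inr_inl_inl h₁ h₂ v x y
  rw [ricci_eq, d.trace_eq, hA₁, hA₂]
  simp only [map_sub, map_smul, LinearMap.trace_id, LinearMap.trace_smulRight, smul_eq_mul,
    ← ricci_eq, laplacian, ContinuousLinearMap.coe_coe, d.metric₁.symm _ h₁ y x]
  ring

/-- Each diagonal block is a multiple of the identity minus a rank-one map, contributing $n_1-1$ and
$n_2-1$ times the same product; hence the constant $n-2$. -/
theorem ricci_inl_inr (d : IsDoublyWarpedOn p₁ p₂ i₁ i₂ G₁ G₂ f₁ f₂ U₁ U₂ G)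
    (h₁ : p₁ e ∈ U₁) (h₂ : p₂ e ∈ U₂) (x : E₁) (w : E₂) :
    ricci G e (i₁ x) (i₂ w) = ((Module.finrank ℝ E₁ : ℝ) + Module.finrank ℝ E₂ - 2)
      * (fderiv ℝ f₁ (p₁ e) x / f₁ (p₁ e)) * (fderiv ℝ f₂ (p₂ e) w / f₂ (p₂ e)) := by
  have hA₁ : (p₁ : E →ₗ[ℝ] E₁) ∘ₗ curvatureMap G e (i₁ x) (i₂ w) ∘ₗ (i₁ : E₁ →ₗ[ℝ] E)
      = (fderiv ℝ f₂ (p₂ e) w / f₂ (p₂ e)) • ((fderiv ℝ f₁ (p₁ e) x / f₁ (p₁ e)) • LinearMap.id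
        - (f₁ (p₁ e))⁻¹ • (fderiv ℝ f₁ (p₁ e) : E₁ →ₗ[ℝ] ℝ).smulRight x) := by
    ext u
    refine (d.fst_curvature_inl_inl_inr h₁ h₂ u x w).trans ?_
    simp [div_eq_inv_mul, mul_smul]
  have hA₂ : (p₂ : E →ₗ[ℝ] E₂) ∘ₗ curvatureMap G e (i₁ x) (i₂ w) ∘ₗ (i₂ : E₂ →ₗ[ℝ] E)
      = (fderiv ℝ f₁ (p₁ e) x / f₁ (p₁ e)) • ((fderiv ℝ f₂ (p₂ e) w / f₂ (p₂ e)) • LinearMap.id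
        - (f₂ (p₂ e))⁻¹ • (G₂ (p₂ e) w : E₂ →ₗ[ℝ] ℝ).smulRight (gradient G₂ f₂ (p₂ e))) := by
    ext v
    refine (d.snd_curvature_inr_inl_inr h₁ h₂ v w x).trans ?_
    simp [div_eq_inv_mul, mul_smul, d.metric₂.symm _ h₂ w v]
  rw [ricci_eq, d.trace_eq, hA₁, hA₂]
  simp only [map_sub, map_smul, LinearMap.trace_id, LinearMap.trace_smulRight, smul_eq_mul,
    ContinuousLinearMap.coe_coe, d.metric₂.symm _ h₂ w, d.metric₂.apply_gradient h₂]
  ring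

/-- The cubic form of the derivative of the Ricci tensor on horizontal vectors. -/
theorem covDeriv_ricci_inl (d : IsDoublyWarpedOn p₁ p₂ i₁ i₂ G₁ G₂ f₁ f₂ U₁ U₂ G)
    (h₁ : p₁ e ∈ U₁) (h₂ : p₂ e ∈ U₂) (x : E₁) :
    covDeriv G (ricci G) e (i₁ x) (i₁ x) (i₁ x) = covDeriv G₁ (ricci G₁) (p₁ e) x x x
      - covDeriv G₁ (fun z v w => Module.finrank ℝ E₂ / f₁ z * hessian G₁ f₁ z v w) (p₁ e) x x x
      + 2 / f₁ (p₁ e) ^ 3 * fderiv ℝ f₁ (p₁ e) x * G₁ (p₁ e) x x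
        * (f₂ (p₂ e) * laplacian G₂ f₂ (p₂ e) + ((Module.finrank ℝ E₁ : ℝ) - 1)
            * fderiv ℝ f₂ (p₂ e) (gradient G₂ f₂ (p₂ e))
          + ((Module.finrank ℝ E₁ : ℝ) + Module.finrank ℝ E₂ - 2)
            * fderiv ℝ f₂ (p₂ e) (gradient G₂ f₂ (p₂ e))) := by
  have n₁ := (d.pos₁ _ h₁).ne'
  have n₂ := (d.pos₂ _ h₂).ne'
  have hdiff := fun {φ : E₁ → ℝ} (hφ : ContDiffOn ℝ ∞ φ U₁) =>
    (differentiableAt_of_contDiffOn d.metric₁.isOpen hφ h₁)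
  have hR := (hdiff (d.metric₁.contDiffOn_ricci x x)).hasFDerivAt
  have hH : HasFDerivAt (fun z => Module.finrank ℝ E₂ / f₁ z * hessian G₁ f₁ z x x) _ (p₁ e) :=
    (hdiff ((contDiffOn_const.div d.contDiffOn₁ fun z hz => (d.pos₁ z hz).ne').mul
      (d.metric₁.contDiffOn_hessian d.contDiffOn₁ x x))).hasFDerivAt
  have hG := hasFDerivAt_div (((d.metric₁.differentiableAt h₁).hasFDerivAt.clm_apply
    (hasFDerivAt_const x (p₁ e))).clm_apply (hasFDerivAt_const x (p₁ e)))
      ((d.hasFDerivAt₁ h₁).pow 2) (pow_ne_zero 2 n₁)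
  -- This is $f_2^\diamond$, a constant for horizontal differentiation.
  set D := f₂ (p₂ e) * laplacian G₂ f₂ (p₂ e) + ((Module.finrank ℝ E₁ : ℝ) - 1)
            * fderiv ℝ f₂ (p₂ e) (gradient G₂ f₂ (p₂ e)) with hD
  have h := (hR.sub hH).sub (hG.mul_const D)
  have hd := d.fderiv_inl h₁ (Φ := fun e' => ricci G e' (i₁ x) (i₁ x))
    (differentiableAt_of_contDiffOn d.isMetricOn.isOpen
      (d.isMetricOn.contDiffOn_ricci _ _) ⟨h₁, h₂⟩)
    (φ := fun z => ricci G₁ z x x - Module.finrank ℝ E₂ / f₁ z * hessian G₁ f₁ z x x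
      - G₁ z x x / f₁ z ^ 2 * D)
    (fun z hz => by
      rw [d.ricci_inl_inl] <;> simp [d.fst_inl, d.fst_inr, d.snd_inl, d.snd_inr, hz, h₂, hD]) x
  have hΓ : ∀ v, ricci G e (i₁ v) (i₁ x) = ricci G e (i₁ x) (i₁ v) := fun v =>
    d.isMetricOn.ricci_symm ⟨h₁, h₂⟩ _ _
  -- The vertical part of $D_XX$ meets the mixed Ricci tensor here; evaluated on $\nabla f_2$, it
  -- yields the $(n-2)$ term.
  have hmix : ricci G e (i₁ x) (christoffel G e (i₁ x) (i₁ x))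
      = ricci G e (i₁ x) (i₁ (christoffel G₁ (p₁ e) x x))
        - (f₂ (p₂ e) / f₁ (p₁ e) ^ 2 * G₁ (p₁ e) x x)
          * ricci G e (i₁ x) (i₂ (gradient G₂ f₂ (p₂ e))) := by
    rw [d.christoffel_inl_inl h₁ h₂, d.isMetricOn.ricci_symm ⟨h₁, h₂⟩, sub_eq_add_neg, ← neg_smul,
      ricci_add_left, ricci_smul_left, d.isMetricOn.ricci_symm ⟨h₁, h₂⟩ (i₂ _), hΓ]
    ring
  simp only [covDeriv]
  rw [hd, d.isMetricOn.ricci_symm ⟨h₁, h₂⟩ (christoffel G e (i₁ x) (i₁ x)), hmix,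
    d.ricci_inl_inl h₁ h₂, d.ricci_inl_inr h₁ h₂, hH.fderiv,
    d.metric₁.ricci_symm h₁ (christoffel G₁ (p₁ e) x x)]
  erw [h.fderiv]
  rw [d.metric₁.hessian_symm d.contDiffOn₁ h₁ (christoffel G₁ (p₁ e) x x)]
  simp [d.metric₁.fderiv_eq_christoffel h₁,
    d.metric₁.symm _ h₁ (christoffel G₁ (p₁ e) x x)]
  clear_value D
  subst hD
  field_simp
  ring

end IsDoublyWarpedOn

end DoublyWarped

end Coord

namespace PseudoRiemannian

/-! ### Passage from a manifold to its preferred charts. -/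

section Chart

variable {E : Type*} [NormedAddCommGroup E] [NormedSpace ℝ E]
  {H : Type*} [TopologicalSpace H] {I : ModelWithCorners ℝ E H}
  {M : Type*} [TopologicalSpace M] [ChartedSpace H M] [IsManifold I ∞ M]
  {g : BilinField I M} {f : M → ℝ} {x : M} {e : E}

theorem contDiffOn_funInChart (hf : ContMDiff I 𝓘(ℝ) ∞ f) (x : M) :
    ContDiffOn ℝ ∞ (funInChart I f x) (extChartAt I x).target := by
  rw [← contMDiffOn_iff_contDiffOn]
  exact hf.comp_contMDiffOn (contMDiffOn_extChartAt_symm x)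

theorem mdifferentiableAt_extChartAt_self (x : M) :
    MDifferentiableAt I 𝓘(ℝ, E) (extChartAt I x) x :=
  mdifferentiableAt_extChartAt (mem_chart_source H x)

theorem coords_surjective (x : M) : Function.Surjective (coords (I := I) x) :=
  (isInvertible_mfderiv_extChartAt (mem_extChartAt_source x)).surjective

omit [IsManifold I ∞ M] in
theorem IsClassA.covDeriv_self (h : IsClassA g) (x : M) (X : TangentSpace I x) :
    covDeriv g (ricci g) x X X X = 0 := by
  have := h x X X X
  linarith

variable [I.Boundaryless]

theorem mdifferentiableAt_extChartAt_symm (he : e ∈ (extChartAt I x).target) :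
    MDifferentiableAt 𝓘(ℝ, E) I (extChartAt I x).symm e :=
  ((contMDiffOn_extChartAt_symm (n := ∞) x).contMDiffAt
    ((isOpen_extChartAt_target x).mem_nhds he)).mdifferentiableAt (by simp)

theorem isInvertible_mfderiv_extChartAt_symm (he : e ∈ (extChartAt I x).target) :
    (mfderiv 𝓘(ℝ, E) I (extChartAt I x).symm e).IsInvertible := by
  have := isInvertible_mfderivWithin_extChartAt_symm he
  rwa [I.range_eq_univ, mfderivWithin_univ] at this

/-- The tangent map of the inverse chart, composed with the smooth constant field `u`. These
coordinate fields are what the metric is evaluated on in `inChart`. -/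
theorem contMDiffOn_mfderiv_extChartAt_symm (x : M) (u : E) :
    ContMDiffOn 𝓘(ℝ, E) I.tangent ∞ (fun e => (⟨(extChartAt I x).symm e,
      mfderiv 𝓘(ℝ, E) I (extChartAt I x).symm e u⟩ : TangentBundle I M))
      (extChartAt I x).target := by
  have hU := isOpen_extChartAt_target (I := I) x
  have h := (contMDiffOn_extChartAt_symm (I := I) (n := ∞) x).contMDiffOn_tangentMapWithin
    (m := ∞) (by simp) hU.uniqueMDiffOn
  have hs : ContMDiff 𝓘(ℝ, E) 𝓘(ℝ, E).tangent ∞ (fun e => (⟨e, u⟩ : TangentBundle 𝓘(ℝ, E) E)) :=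
    (contMDiff_vectorSpace_iff_contDiff (V := fun _ => u)).2 contDiff_const
  refine (h.comp hs.contMDiffOn fun e he => he).congr fun e he => ?_
  simp only [Function.comp_apply, tangentMapWithin]
  rw [mfderivWithin_of_isOpen hU he]

theorem IsMetric.isMetricOn_inChart [FiniteDimensional ℝ E] (hg : IsMetric g) (x : M) :
    Coord.IsMetricOn (inChart g x) (extChartAt I x).target where
  isOpen := isOpen_extChartAt_target x
  symm e _ v w := by rw [inChart_apply, inChart_apply, hg.symm]
  nondegenerate e he v hv := by
    have hA := isInvertible_mfderiv_extChartAt_symm he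
    refine hA.injective ((hg.nondegenerate _ _ fun w => ?_).trans (map_zero _).symm)
    obtain ⟨w, rfl⟩ := hA.surjective w
    exact hv w
  contDiffOn := by
    refine contDiffOn_clm_apply.2 fun v => contDiffOn_clm_apply.2 fun w => ?_
    have h1 := hg.contMDiff.comp_contMDiffOn (contMDiffOn_extChartAt_symm (I := I) (n := ∞) x)
    -- Smoothness is proved for a section of the trivial line bundle along the inverse chart; its
    -- fibre component is the coordinate function sought.
    have h2 : ContMDiffOn 𝓘(ℝ, E) (I.prod 𝓘(ℝ, ℝ)) ∞
        (fun e => Bundle.TotalSpace.mk' ℝ (E := Bundle.Trivial M ℝ) ((extChartAt I x).symm e)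
          (inChart g x e v w)) (extChartAt I x).target := by
      apply ContMDiffOn.clm_bundle_apply₂ (F₁ := E) (F₂ := E)
      · exact h1
      · exact contMDiffOn_mfderiv_extChartAt_symm x v
      · exact contMDiffOn_mfderiv_extChartAt_symm x w
    rw [← contMDiffOn_iff_contDiffOn]
    intro e he
    have h3 := h2 e he
    rw [Bundle.contMDiffWithinAt_totalSpace] at h3
    exact h3.2

theorem mvfderiv_eq_fderiv_funInChart (hf : ContMDiff I 𝓘(ℝ) ∞ f) (x : M)
    (X : TangentSpace I x) :
    mvfderiv I f x X = fderiv ℝ (funInChart I f x) (extChartAt I x x) (coords x X) := by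
  have h1 : f =ᶠ[nhds x] funInChart I f x ∘ extChartAt I x := by
    filter_upwards [extChartAt_source_mem_nhds (I := I) x] with y hy
    exact congrArg f ((extChartAt I x).left_inv hy).symm
  have h2 : MDifferentiableAt 𝓘(ℝ, E) 𝓘(ℝ) (funInChart I f x) (extChartAt I x x) :=
    (Coord.differentiableAt_of_contDiffOn (isOpen_extChartAt_target x)
      (contDiffOn_funInChart hf x) (mem_extChartAt_target x)).mdifferentiableAt
  have h3 := mfderiv_comp_apply x h2 (mdifferentiableAt_extChartAt_self x) X
  rw [← h1.mfderiv_eq, mfderiv_eq_fderiv] at h3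
  exact h3

theorem inChart_coords (g : BilinField I M) (x : M) (X Y : TangentSpace I x) :
    inChart g x (extChartAt I x x) (coords x X) (coords x Y) = g x X Y := by
  -- The point reached by going to the chart and back equals `x` only propositionally; since every
  -- tangent space is a copy of `E`, the metric is transported with unchanged vectors.
  have h1 : ∀ y, y = x → ∀ v w : E, g y v w = g x v w := by rintro _ rfl v w; rfl
  have h2 := mfderivWithin_extChartAt_symm_comp_mfderiv_extChartAt' (I := I)
    (mem_extChartAt_source (I := I) x)
  rw [I.range_eq_univ, mfderivWithin_univ] at h2
  have h3 : ∀ X : TangentSpace I x,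
      mfderiv 𝓘(ℝ, E) I (extChartAt I x).symm (extChartAt I x x)
        (coords (I := I) (E := E) x X) = X :=
    fun X => congrArg (fun A : TangentSpace I x →L[ℝ] TangentSpace I x => A X) h2
  rw [inChart_apply]
  refine (h1 _ (extChartAt_to_inv x) _ _).trans ?_
  erw [h3, h3]

/-- Polarization; it applies because every coordinate vector at `x` comes from a tangent vector. -/
theorem isClassA_iff [FiniteDimensional ℝ E] (hg : IsMetric g) :
    IsClassA g ↔ ∀ (x : M) (X : TangentSpace I x), covDeriv g (ricci g) x X X X = 0 := by
  refine ⟨fun h => h.covDeriv_self, fun h x X Y Z => ?_⟩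
  refine (hg.isMetricOn_inChart x).cyclic_sum_covDeriv_eq_zero (mem_extChartAt_target x)
    (fun u => ?_) _ _ _
  obtain ⟨X, rfl⟩ := coords_surjective (I := I) x u
  exact h x X

end Chart

end PseudoRiemannian

namespace PseudoRiemannian

/-! ### The doubly warped product manifold in product charts. -/

section Product

variable {E₁ : Type*} [NormedAddCommGroup E₁] [NormedSpace ℝ E₁]
  {H₁ : Type*} [TopologicalSpace H₁] {I₁ : ModelWithCorners ℝ E₁ H₁} [I₁.Boundaryless]
  {M₁ : Type*} [TopologicalSpace M₁] [ChartedSpace H₁ M₁] [IsManifold I₁ ∞ M₁]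
  {E₂ : Type*} [NormedAddCommGroup E₂] [NormedSpace ℝ E₂]
  {H₂ : Type*} [TopologicalSpace H₂] {I₂ : ModelWithCorners ℝ E₂ H₂} [I₂.Boundaryless]
  {M₂ : Type*} [TopologicalSpace M₂] [ChartedSpace H₂ M₂] [IsManifold I₂ ∞ M₂]
  {g₁ : BilinField I₁ M₁} {g₂ : BilinField I₂ M₂} {f₁ : M₁ → ℝ} {f₂ : M₂ → ℝ}

omit [I₁.Boundaryless] [I₂.Boundaryless] in
theorem coords_prod (p : M₁ × M₂) (X : TangentSpace (I₁.prod I₂) p) :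
    (coords p X : E₁ × E₂) = (coords (I := I₁) p.1 X.1, coords (I := I₂) p.2 X.2) := by
  have hp := mdifferentiableAt_extChartAt_self (I := I₁.prod I₂) p
  refine Prod.ext ?_ ?_
  · have h1 := mfderiv_comp_apply (I' := 𝓘(ℝ, E₁ × E₂)) (I'' := 𝓘(ℝ, E₁)) (g := Prod.fst) p
      differentiableAt_fst.mdifferentiableAt hp X
    have h2 := mfderiv_comp_apply (g := extChartAt I₁ p.1) (f := Prod.fst) p
      (mdifferentiableAt_extChartAt_self p.1) (mdifferentiableAt_fst (I := I₁) (I' := I₂)) X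
    rw [mfderiv_eq_fderiv, fderiv_fst] at h1
    rw [mfderiv_fst] at h2
    exact h1.symm.trans h2
  · have h1 := mfderiv_comp_apply (I' := 𝓘(ℝ, E₁ × E₂)) (I'' := 𝓘(ℝ, E₂)) (g := Prod.snd) p
      differentiableAt_snd.mdifferentiableAt hp X
    have h2 := mfderiv_comp_apply (g := extChartAt I₂ p.2) (f := Prod.snd) p
      (mdifferentiableAt_extChartAt_self p.2) (mdifferentiableAt_snd (I := I₁) (I' := I₂)) X
    rw [mfderiv_eq_fderiv, fderiv_snd] at h1
    rw [mfderiv_snd] at h2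
    exact h1.symm.trans h2

theorem mfderiv_extChartAt_symm_prod (p : M₁ × M₂) {e : E₁ × E₂}
    (h₁ : e.1 ∈ (extChartAt I₁ p.1).target) (h₂ : e.2 ∈ (extChartAt I₂ p.2).target)
    (v : E₁ × E₂) :
    (mfderiv 𝓘(ℝ, E₁ × E₂) (I₁.prod I₂) (extChartAt (I₁.prod I₂) p).symm e v : E₁ × E₂)
      = (mfderiv 𝓘(ℝ, E₁) I₁ (extChartAt I₁ p.1).symm e.1 v.1,
        mfderiv 𝓘(ℝ, E₂) I₂ (extChartAt I₂ p.2).symm e.2 v.2) := by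
  have he : e ∈ (extChartAt (I₁.prod I₂) p).target := by
    rw [extChartAt_prod]
    exact ⟨h₁, h₂⟩
  have hp := mdifferentiableAt_extChartAt_symm he
  refine Prod.ext ?_ ?_
  · have h1 := mfderiv_comp_apply (I'' := I₁) (g := Prod.fst) e
      (mdifferentiableAt_fst (I := I₁) (I' := I₂)) hp v
    have h2 := mfderiv_comp_apply (I' := 𝓘(ℝ, E₁)) (g := (extChartAt I₁ p.1).symm)
      (f := (Prod.fst : E₁ × E₂ → E₁)) e
      (mdifferentiableAt_extChartAt_symm h₁) differentiableAt_fst.mdifferentiableAt v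
    rw [mfderiv_fst] at h1
    rw [mfderiv_eq_fderiv, fderiv_fst] at h2
    exact h1.symm.trans h2
  · have h1 := mfderiv_comp_apply (I'' := I₂) (g := Prod.snd) e
      (mdifferentiableAt_snd (I := I₁) (I' := I₂)) hp v
    have h2 := mfderiv_comp_apply (I' := 𝓘(ℝ, E₂)) (g := (extChartAt I₂ p.2).symm)
      (f := (Prod.snd : E₁ × E₂ → E₂)) e
      (mdifferentiableAt_extChartAt_symm h₂) differentiableAt_snd.mdifferentiableAt v
    rw [mfderiv_snd] at h1
    rw [mfderiv_eq_fderiv, fderiv_snd] at h2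
    exact h1.symm.trans h2

/-- In a product chart, the doubly warped product metric is a doubly warped product. -/
theorem isDoublyWarpedOn_inChart [FiniteDimensional ℝ E₁] [FiniteDimensional ℝ E₂]
    (hg₁ : IsMetric g₁) (hg₂ : IsMetric g₂)
    (hf₁ : ContMDiff I₁ 𝓘(ℝ) ∞ f₁) (hf₁_pos : ∀ x, 0 < f₁ x)
    (hf₂ : ContMDiff I₂ 𝓘(ℝ) ∞ f₂) (hf₂_pos : ∀ y, 0 < f₂ y) (p : M₁ × M₂) :
    Coord.IsDoublyWarpedOn (ContinuousLinearMap.fst ℝ E₁ E₂) (ContinuousLinearMap.snd ℝ E₁ E₂)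
      (ContinuousLinearMap.inl ℝ E₁ E₂) (ContinuousLinearMap.inr ℝ E₁ E₂)
      (inChart g₁ p.1) (inChart g₂ p.2) (funInChart I₁ f₁ p.1) (funInChart I₂ f₂ p.2)
      (extChartAt I₁ p.1).target (extChartAt I₂ p.2).target
      (inChart (doublyWarped g₁ g₂ f₁ f₂) p) where
  fst_inl x := rfl
  fst_inr y := rfl
  snd_inl x := rfl
  snd_inr y := rfl
  inl_add_inr z := by simp
  metric₁ := hg₁.isMetricOn_inChart p.1
  metric₂ := hg₂.isMetricOn_inChart p.2
  contDiffOn₁ := contDiffOn_funInChart hf₁ p.1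
  contDiffOn₂ := contDiffOn_funInChart hf₂ p.2
  pos₁ x _ := hf₁_pos _
  pos₂ y _ := hf₂_pos _
  apply_eq e h₁ h₂ v w := by
    rw [inChart_apply, doublyWarped_apply]
    have hv := mfderiv_extChartAt_symm_prod p h₁ h₂ v
    have hw := mfderiv_extChartAt_symm_prod p h₁ h₂ w
    erw [hv, hw]
    rfl

variable [FiniteDimensional ℝ E₁] [FiniteDimensional ℝ E₂]

/-- The coordinate identity at the chart image of `(x, y)`: a vector tangent to the first factor has
coordinates in the first summand, and chart values of functions and metrics are the intrinsic ones.
-/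
theorem covDeriv_ricci_doublyWarped_inl (hg₁ : IsMetric g₁) (hg₂ : IsMetric g₂)
    (hf₁ : ContMDiff I₁ 𝓘(ℝ) ∞ f₁) (hf₁_pos : ∀ x, 0 < f₁ x)
    (hf₂ : ContMDiff I₂ 𝓘(ℝ) ∞ f₂) (hf₂_pos : ∀ y, 0 < f₂ y) (x : M₁) (y : M₂)
    (X : TangentSpace I₁ x) (X' : TangentSpace (I₁.prod I₂) (x, y)) (hX' : X' = (X, (0 : E₂))) :
    covDeriv (doublyWarped g₁ g₂ f₁ f₂) (ricci (doublyWarped g₁ g₂ f₁ f₂)) (x, y) X' X' X'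
      = covDeriv g₁ (ricci g₁) x X X X
        - covDeriv g₁ (warpingHessian g₁ (Module.finrank ℝ E₂) f₁) x X X X
        + 2 / f₁ x ^ 3 * mvfderiv I₁ f₁ x X * g₁ x X X
          * (diamond g₂ (Module.finrank ℝ E₁) f₂ y
            + ((Module.finrank ℝ E₁ : ℝ) + Module.finrank ℝ E₂ - 2) * gradSq g₂ f₂ y) := by
  have d := isDoublyWarpedOn_inChart hg₁ hg₂ hf₁ hf₁_pos hf₂ hf₂_pos (x, y)
  have h := d.covDeriv_ricci_inl (e := (extChartAt I₁ x x, extChartAt I₂ y y))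
    (mem_extChartAt_target x) (mem_extChartAt_target y) (coords x X)
  have hc : (coords (x, y) X' : E₁ × E₂)
      = ContinuousLinearMap.inl ℝ E₁ E₂ (coords x X) := by
    rw [coords_prod, hX']
    exact Prod.ext rfl (map_zero (mfderiv I₂ 𝓘(ℝ, E₂) (extChartAt I₂ y) y))
  have e₁ : funInChart I₁ f₁ x (extChartAt I₁ x x) = f₁ x := congrArg f₁ (extChartAt_to_inv x)
  have e₂ : funInChart I₂ f₂ y (extChartAt I₂ y y) = f₂ y := congrArg f₂ (extChartAt_to_inv y)
  simp only [ContinuousLinearMap.coe_fst', ContinuousLinearMap.coe_snd', e₁, e₂, inChart_coords,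
    ← mvfderiv_eq_fderiv_funInChart hf₁] at h
  rw [covDeriv, hc]
  exact h

theorem covDeriv_ricci_doublyWarped_inr (hg₁ : IsMetric g₁) (hg₂ : IsMetric g₂)
    (hf₁ : ContMDiff I₁ 𝓘(ℝ) ∞ f₁) (hf₁_pos : ∀ x, 0 < f₁ x)
    (hf₂ : ContMDiff I₂ 𝓘(ℝ) ∞ f₂) (hf₂_pos : ∀ y, 0 < f₂ y) (x : M₁) (y : M₂)
    (Y : TangentSpace I₂ y) (Y' : TangentSpace (I₁.prod I₂) (x, y)) (hY' : Y' = ((0 : E₁), Y)) :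
    covDeriv (doublyWarped g₁ g₂ f₁ f₂) (ricci (doublyWarped g₁ g₂ f₁ f₂)) (x, y) Y' Y' Y'
      = covDeriv g₂ (ricci g₂) y Y Y Y
        - covDeriv g₂ (warpingHessian g₂ (Module.finrank ℝ E₁) f₂) y Y Y Y
        + 2 / f₂ y ^ 3 * mvfderiv I₂ f₂ y Y * g₂ y Y Y
          * (diamond g₁ (Module.finrank ℝ E₂) f₁ x
            + ((Module.finrank ℝ E₂ : ℝ) + Module.finrank ℝ E₁ - 2) * gradSq g₁ f₁ x) := by
  have d := isDoublyWarpedOn_inChart hg₁ hg₂ hf₁ hf₁_pos hf₂ hf₂_pos (x, y)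
  have h := d.swap.covDeriv_ricci_inl (e := (extChartAt I₁ x x, extChartAt I₂ y y))
    (mem_extChartAt_target y) (mem_extChartAt_target x) (coords y Y)
  have hc : (coords (x, y) Y' : E₁ × E₂)
      = ContinuousLinearMap.inr ℝ E₁ E₂ (coords y Y) := by
    rw [coords_prod, hY']
    exact Prod.ext (map_zero (mfderiv I₁ 𝓘(ℝ, E₁) (extChartAt I₁ x) x)) rfl
  have e₁ : funInChart I₁ f₁ x (extChartAt I₁ x x) = f₁ x := congrArg f₁ (extChartAt_to_inv x)
  have e₂ : funInChart I₂ f₂ y (extChartAt I₂ y y) = f₂ y := congrArg f₂ (extChartAt_to_inv y)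
  simp only [ContinuousLinearMap.coe_fst', ContinuousLinearMap.coe_snd', e₁, e₂, inChart_coords,
    ← mvfderiv_eq_fderiv_funInChart hf₂] at h
  rw [covDeriv, hc]
  exact h

end Product

end PseudoRiemannian

/-! ### The equivalence for both factors. -/

open PseudoRiemannian in
theorem mainTheorem1
    {E₁ : Type*} [NormedAddCommGroup E₁] [NormedSpace ℝ E₁] [FiniteDimensional ℝ E₁]
    {H₁ : Type*} [TopologicalSpace H₁] (I₁ : ModelWithCorners ℝ E₁ H₁) [I₁.Boundaryless]
    {M₁ : Type*} [TopologicalSpace M₁] [ChartedSpace H₁ M₁] [IsManifold I₁ ∞ M₁] [Nonempty M₁]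
    {E₂ : Type*} [NormedAddCommGroup E₂] [NormedSpace ℝ E₂] [FiniteDimensional ℝ E₂]
    {H₂ : Type*} [TopologicalSpace H₂] (I₂ : ModelWithCorners ℝ E₂ H₂) [I₂.Boundaryless]
    {M₂ : Type*} [TopologicalSpace M₂] [ChartedSpace H₂ M₂] [IsManifold I₂ ∞ M₂] [Nonempty M₂]
    (g₁ : BilinField I₁ M₁) (hg₁ : IsMetric g₁) (g₂ : BilinField I₂ M₂) (hg₂ : IsMetric g₂)
    (f₁ : M₁ → ℝ) (hf₁ : ContMDiff I₁ 𝓘(ℝ) ∞ f₁) (hf₁_pos : ∀ x, 0 < f₁ x)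
    (f₂ : M₂ → ℝ) (hf₂ : ContMDiff I₂ 𝓘(ℝ) ∞ f₂) (hf₂_pos : ∀ y, 0 < f₂ y)
    (n₁ n₂ n : ℕ) (hn₁ : n₁ = Module.finrank ℝ E₁) (hn₂ : n₂ = Module.finrank ℝ E₂)
    (hn : n = n₁ + n₂)
    (hA : IsClassA (doublyWarped g₁ g₂ f₁ f₂)) :
    (IsClassA g₁ ↔ ∀ (x : M₁) (y : M₂) (X : TangentSpace I₁ x),
      covDeriv g₁ (warpingHessian g₁ n₂ f₁) x X X X
        = 2 / f₁ x ^ 3 * mvfderiv I₁ f₁ x X * g₁ x X X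
          * (diamond g₂ n₁ f₂ y + ((n : ℝ) - 2) * gradSq g₂ f₂ y))
    ∧ (IsClassA g₂ ↔ ∀ (x : M₁) (y : M₂) (Y : TangentSpace I₂ y),
      covDeriv g₂ (warpingHessian g₂ n₁ f₂) y Y Y Y
        = 2 / f₂ y ^ 3 * mvfderiv I₂ f₂ y Y * g₂ y Y Y
          * (diamond g₁ n₂ f₁ x + ((n : ℝ) - 2) * gradSq g₁ f₁ x)) := by

  subst hn hn₁ hn₂
  push_cast
  refine ⟨(isClassA_iff hg₁).trans ⟨fun h x y X => ?_, fun h x X => ?_⟩,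
    (isClassA_iff hg₂).trans ⟨fun h x y Y => ?_, fun h y Y => ?_⟩⟩
  · have h1 := (covDeriv_ricci_doublyWarped_inl hg₁ hg₂ hf₁ hf₁_pos hf₂ hf₂_pos x y X _ rfl).symm.trans
      (hA.covDeriv_self (x, y) _)
    have h2 := h x X
    linarith
  -- The condition is only available at points of the product, so some point of the other factor is
  -- needed; any one will do.
  · obtain ⟨y⟩ := ‹Nonempty M₂›
    have h1 := (covDeriv_ricci_doublyWarped_inl hg₁ hg₂ hf₁ hf₁_pos hf₂ hf₂_pos x y X _ rfl).symm.trans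
      (hA.covDeriv_self (x, y) _)
    have h2 := h x y X
    linarith
  · have h1 := (covDeriv_ricci_doublyWarped_inr hg₁ hg₂ hf₁ hf₁_pos hf₂ hf₂_pos x y Y _ rfl).symm.trans
      (hA.covDeriv_self (x, y) _)
    have h2 := h y Y
    -- Exchanging the factors produced $n_2+n_1$ in place of $n_1+n_2$.
    rw [add_comm (Module.finrank ℝ E₂ : ℝ)] at h1
    linarith
  · obtain ⟨x⟩ := ‹Nonempty M₁›
    have h1 := (covDeriv_ricci_doublyWarped_inr hg₁ hg₂ hf₁ hf₁_pos hf₂ hf₂_pos x y Y _ rfl).symm.trans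
      (hA.covDeriv_self (x, y) _)
    have h2 := h x y Y
    rw [add_comm (Module.finrank ℝ E₂ : ℝ)] at h1
    linarith
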